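/- **Setting.** Let $T>0$, $d\in\mathbb N$, let $A\in\mathbb R^{d\times d}$ be symmetric positive definite, $z_0\in\mathbb R^d$, and let $\mathcal F\in C^2(\mathbb R^d;\mathbb R)$ satisfy $\mathcal F\ge 0$ and $\|D^2\mathcal F(z)v\|\le C(1+\|z\|^q)\|v\|$ for all $z,v\in\mathbb R^d$, with some $C>0$, $q\ge 1$. Let $\mathcal R:\mathbb R^d\to[0,\infty)$ be convex, lower semicontinuous and positively 1-homogeneous with $c\|z\|\le\mathcal R(z)\le C\|z\|$ for all $z$, for some $c,C>0$. Put $\mathcal E(z)=\frac12\langle Az,z\rangle+\mathcal F(z)$, and assume that $-D_z\mathcal E(z_0)+\ell_0\in\partial\mathcal R(0)$ for some $\ell_0\in\mathbb R^d$. $BV([0,S];\mathbb R^d)$ is the space of functions $f:[0,S]\to\mathbb R^d$ of finite pointwise variation, with norm $\|f\|_{L^1(0,S)}+\mathrm{Var}(f;[0,S])$. Weak* convergence $f_n\rightharpoonup^* f$ in $BV(0,S;\mathbb R^d)$ means $f_n\to f$ in $L^1(0,S;\mathbb R^d)$ and $Df_n\rightharpoonup^* Df$ as $\mathbb R^d$-valued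 measures on $(0,S)$, tested with $C_0((0,S))$. Weak* convergence in $W^{1,\infty}(0,S)$ means weak* convergence in $L^\infty(0,S)$ of the functions and of their weak derivatives. **Relaxed solutions.** Let $\ell\in BV([0,T];\mathbb R^d)$. A tuple $(S,\hat t,\hat z,\hat\ell)\in(0,\infty)\times W^{1,\infty}(0,S)\times W^{1,\infty}(0,S;\mathbb R^d)\times BV([0,S];\mathbb R^d)$ (with the continuous representatives of $\hat t,\hat z$) is a *relaxed (normalized, $\mathfrak p$-parametrized BV) solution associated with $\ell$* if, with $\hat{\mathcal I}(s,z)=\mathcal E(z)-\langle\hat\ell(s),z\rangle$ and $\mathrm d(s):=\operatorname{dist}(-D_z\hat{\mathcal I}(s,\hat z(s)),\partial\mathcal R(0))$, * $\hat t(0)=0$, $\hat t(S)=T$, $\hat z(0)=z_0$; * for a.a. $s\in(0,S)$: $\hat t'(s)\ge0$, $\hat t'(s)\,\mathrm d(s)=0$ and $\hat t'(s)+\mathcal R(\hat z'(s))+\|\hat z'(s)\|\,\mathrm d(s)=1$; * for all $s_1,s_2\in[0,S]$: $\mathcal E(\hat z(s_2))+\int_{s_1}^{s_2}\mathcal R(\hat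 z'(r))+\|\hat z'(r)\|\,\mathrm d(r)\,dr=\mathcal E(\hat z(s_1))+\int_{s_1}^{s_2}\langle\hat\ell(r),\hat z'(r)\rangle\,dr$; * $\hat\ell(s)=\ell(\hat t(s))$ for a.a. $s\in M=\{s\in(0,S):\hat t(s_1)<\hat t(s_2)\text{ for all }s_1,s_2\in[0,S]\text{ with }s_1<s<s_2\}$. **Theorem.** Let $(\ell_n)_{n\in\mathbb N}$ be bounded in $BV([0,T];\mathbb R^d)$, let $(S_n,\hat t_n,\hat z_n,\hat\ell_n)$ be a relaxed solution associated with $\ell_n$ for each $n$, and assume that $(\|\hat\ell_n\|_{BV([0,S_n];\mathbb R^d)})_{n\in\mathbb N}$ is bounded. Then there exist a subsequence (not relabelled), $\ell\in BV([0,T];\mathbb R^d)$ and $(S,\hat t,\hat z,\hat\ell)$ such that $$S_n\to S,\qquad \hat z_n\rightharpoonup^*\hat z\ \text{ in }W^{1,\infty}(0,S;\mathbb R^d),\qquad \hat t_n\rightharpoonup^*\hat t\ \text{ in }W^{1,\infty}(0,S),$$ $$\hat\ell_n\rightharpoonup^*\hat\ell\ \text{ in }BV(0,S;\mathbb R^d),\qquad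 \ell_n\rightharpoonup^*\ell\ \text{ in }BV(0,T;\mathbb R^d),$$ $$\hat\ell_n(s)\to\hat\ell(s)\ \text{ for all }s\in[0,S],\qquad \ell_n(t)\to\ell(t)\ \text{ for all }t\in[0,T],$$ where $\hat t_n,\hat z_n,\hat\ell_n$ are extended by the constant values $\hat t_n(S_n),\hat z_n(S_n),\hat\ell_n(S_n)$ to $[0,S]$ if $S_n<S$ (and restricted to $[0,S]$ if $S_n>S$). Moreover, $(S,\hat t,\hat z,\hat\ell)$ is a relaxed solution associated with $\ell$. -/

import Mathlib

open MeasureTheory Set Filter Topology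
open scoped ENNReal NNReal InnerProductSpace

noncomputable section

/-! A function on `[0, S]` is represented by a function on `ℝ`; every notion below depends only on
its values on `[0, S]`. -/

/-- Lebesgue measure on the open interval `(0, S)`. -/
def lebesgueOn (S : ℝ) : Measure ℝ := volume.restrict (Ioo 0 S)

/-! ### The space `BV([0, S]; V)` of everywhere defined functions -/

/-- `f ∈ BV([0, S]; V)`, that is, `Var(f; [0, S]) < ∞`. -/
def MemBV {V : Type*} [NormedAddCommGroup V] (S : ℝ) (f : ℝ → V) : Prop :=
  eVariationOn f (Icc 0 S) < ∞

/-- The norm `‖f‖_{L¹(0, S)} + Var(f; [0, S])` of `BV([0, S]; V)`, with values in `[0, ∞]`. -/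
def bvNorm {V : Type*} [NormedAddCommGroup V] (S : ℝ) (f : ℝ → V) : ℝ≥0∞ :=
  eLpNorm f 1 (lebesgueOn S) + eVariationOn f (Icc 0 S)

/-! ### Test functions, `W^{1,∞}(0, S; V)` and its weak* convergence -/

/-- `φ ∈ C_c^∞((0, S); ℝ)`. -/
structure IsTestFunction (S : ℝ) (φ : ℝ → ℝ) : Prop where
  smooth : ContDiff ℝ (⊤ : ℕ∞) φ
  compact : HasCompactSupport φ
  supp : tsupport φ ⊆ Ioo 0 S

/-- `f ∈ W^{1,∞}(0, S; V)` and `f'` is its weak derivative. -/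
structure HasW1infDeriv {V : Type*} [NormedAddCommGroup V] [NormedSpace ℝ V]
    (S : ℝ) (f f' : ℝ → V) : Prop where
  memLp : MemLp f ∞ (lebesgueOn S)
  memLp_deriv : MemLp f' ∞ (lebesgueOn S)
  weak_deriv : ∀ φ : ℝ → ℝ, IsTestFunction S φ →
    ∫ s, deriv φ s • f s ∂(lebesgueOn S) = - ∫ s, φ s • f' s ∂(lebesgueOn S)

/-- `f_n ⇀* g` in `L^∞(0, S; V) = L¹(0, S; V)*`. -/
structure LinfWeakStar {V : Type*} [NormedAddCommGroup V] [InnerProductSpace ℝ V]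
    (S : ℝ) (f : ℕ → ℝ → V) (g : ℝ → V) : Prop where
  memLp : ∀ n, MemLp (f n) ∞ (lebesgueOn S)
  memLp_lim : MemLp g ∞ (lebesgueOn S)
  tendsto : ∀ w : ℝ → V, Integrable w (lebesgueOn S) →
    Tendsto (fun n => ∫ s, ⟪f n s, w s⟫_ℝ ∂(lebesgueOn S)) atTop
      (𝓝 (∫ s, ⟪g s, w s⟫_ℝ ∂(lebesgueOn S)))

/-- `f_n ⇀* g` in `W^{1,∞}(0, S; V)`: the functions and their weak derivatives converge weakly*
in `L^∞(0, S; V)`. -/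
def W1infWeakStar {V : Type*} [NormedAddCommGroup V] [InnerProductSpace ℝ V]
    (S : ℝ) (f : ℕ → ℝ → V) (g : ℝ → V) : Prop :=
  ∃ (f' : ℕ → ℝ → V) (g' : ℝ → V),
    (∀ n, HasW1infDeriv S (f n) (f' n)) ∧ HasW1infDeriv S g g' ∧
    LinfWeakStar S f g ∧ LinfWeakStar S f' g'

/-! ### The space `BV(0, S; V)` and its weak* convergence -/

/-- The integral `∫ φ dμ ∈ V` of a real function against a `V`-valued measure. -/
def vmIntegral {V : Type*} [NormedAddCommGroup V] [NormedSpace ℝ V]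
    (μ : VectorMeasure ℝ V) (φ : ℝ → ℝ) : V :=
  μ.integral φ (ContinuousLinearMap.lsmul ℝ ℝ)

/-- `f ∈ BV(0, S; V)` and `μ = Df`: `f` is in `L¹(0, S; V)`, and its distributional derivative on
`(0, S)` is the `V`-valued Borel measure `μ` on `(0, S)` (a measure on `ℝ` concentrated on
`(0, S)`), of finite total variation. -/
structure HasDerivMeasure {V : Type*} [NormedAddCommGroup V] [NormedSpace ℝ V]
    (S : ℝ) (f : ℝ → V) (μ : VectorMeasure ℝ V) : Prop where
  memLp : MemLp f 1 (lebesgueOn S)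
  concentrated : μ.restrict (Ioo 0 S) = μ
  finite_variation : IsFiniteMeasure μ.variation
  weak_deriv : ∀ φ : ℝ → ℝ, IsTestFunction S φ →
    ∫ s, deriv φ s • f s ∂(lebesgueOn S) = - vmIntegral μ φ

/-- `f_n ⇀* g` in `BV(0, S; V)`: `f_n → g` in `L¹(0, S; V)` and `Df_n ⇀* Dg` in
`𝔐(0, S; V)`, that is, tested with `C₀((0, S))`: the continuous functions which, extended by zero,
are continuous on `ℝ`. -/
def BVWeakStar {V : Type*} [NormedAddCommGroup V] [NormedSpace ℝ V]
    (S : ℝ) (f : ℕ → ℝ → V) (g : ℝ → V) : Prop :=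
  Tendsto (fun n => eLpNorm (f n - g) 1 (lebesgueOn S)) atTop (𝓝 0) ∧
  ∃ (μ : ℕ → VectorMeasure ℝ V) (ν : VectorMeasure ℝ V),
    (∀ n, HasDerivMeasure S (f n) (μ n)) ∧ HasDerivMeasure S g ν ∧
    ∀ φ : ℝ → ℝ, Continuous φ → (∀ s, s ∉ Ioo 0 S → φ s = 0) →
      Tendsto (fun n => vmIntegral (μ n) φ) atTop (𝓝 (vmIntegral ν φ))

/-! ### The rate-independent system -/

/-- The convex subdifferential `∂R(x)`. -/
def subdifferential {V : Type*} [NormedAddCommGroup V] [InnerProductSpace ℝ V]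
    (R : V → ℝ) (x : V) : Set V :=
  {w | ∀ v, R x + ⟪w, v - x⟫_ℝ ≤ R v}

/-- The data of a rate-independent system in `ℝ^d`: the matrix `A`, the nonlinearity `F`, the
dissipation `R`, the initial state `z₀` and the end time `T`. -/
structure RISystem (d : ℕ) where
  A : Matrix (Fin d) (Fin d) ℝ
  F : EuclideanSpace ℝ (Fin d) → ℝ
  R : EuclideanSpace ℝ (Fin d) → ℝ
  z₀ : EuclideanSpace ℝ (Fin d)
  T : ℝ

namespace RISystem

variable {d : ℕ}

/-- The load-free energy `E(z) = ½⟨Az, z⟩ + F(z)`. -/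
def energy (P : RISystem d) (z : EuclideanSpace ℝ (Fin d)) : ℝ :=
  (1 / 2) * ⟪Matrix.toEuclideanCLM (𝕜 := ℝ) P.A z, z⟫_ℝ + P.F z

/-- The energy `I(s, z) = E(z) - ⟨l(s), z⟩` under the load `l`. -/
def loadedEnergy (P : RISystem d) (l : ℝ → EuclideanSpace ℝ (Fin d)) (s : ℝ)
    (z : EuclideanSpace ℝ (Fin d)) : ℝ :=
  P.energy z - ⟪l s, z⟫_ℝ

/-- The standing assumptions on the data. (`R` is finite, so it is proper.) -/
structure StandingAssumptions (P : RISystem d) : Prop where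
  T_pos : 0 < P.T
  A_posDef : P.A.PosDef
  F_smooth : ContDiff ℝ 2 P.F
  F_nonneg : ∀ z, 0 ≤ P.F z
  F_growth : ∃ C q : ℝ, 0 < C ∧ 1 ≤ q ∧ ∀ z v,
    ‖fderiv ℝ (gradient P.F) z v‖ ≤ C * (1 + ‖z‖ ^ q) * ‖v‖
  R_convex : ConvexOn ℝ univ P.R
  R_lsc : LowerSemicontinuous P.R
  R_hom : ∀ (r : ℝ) (z : EuclideanSpace ℝ (Fin d)), 0 < r → P.R (r • z) = r * P.R z
  R_bounds : ∃ c C : ℝ, 0 < c ∧ 0 < C ∧ ∀ z, c * ‖z‖ ≤ P.R z ∧ P.R z ≤ C * ‖z‖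
  initial : ∃ l₀ : EuclideanSpace ℝ (Fin d),
    - gradient P.energy P.z₀ + l₀ ∈ subdifferential P.R 0

/-- `dist(-D_z I(s, z), ∂R(0))` under the load `l`. -/
def stabilityDist (P : RISystem d) (l : ℝ → EuclideanSpace ℝ (Fin d)) (s : ℝ)
    (z : EuclideanSpace ℝ (Fin d)) : ℝ :=
  Metric.infDist (- gradient (P.loadedEnergy l s) z) (subdifferential P.R 0)

/-- The set of points of `(0, S)` at which `t` is increasing. -/
def increasePoints (S : ℝ) (t : ℝ → ℝ) : Set ℝ :=
  {s ∈ Ioo 0 S | ∀ s₁ ∈ Icc 0 S, ∀ s₂ ∈ Icc 0 S, s₁ < s → s < s₂ → t s₁ < t s₂}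

/-- The conditions on a relaxed solution in terms of `t, z ∈ W^{1,∞}(0, S)` (continuous
representatives) and their weak derivatives `t', z'`. -/
structure IsRelaxedSolutionWith (P : RISystem d) (l : ℝ → EuclideanSpace ℝ (Fin d))
    (S : ℝ) (t : ℝ → ℝ) (z lh : ℝ → EuclideanSpace ℝ (Fin d))
    (t' : ℝ → ℝ) (z' : ℝ → EuclideanSpace ℝ (Fin d)) : Prop where
  S_pos : 0 < S
  t_cont : ContinuousOn t (Icc 0 S)
  z_cont : ContinuousOn z (Icc 0 S)
  t_w1inf : HasW1infDeriv S t t'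
  z_w1inf : HasW1infDeriv S z z'
  lh_bv : MemBV S lh
  t_zero : t 0 = 0
  t_end : t S = P.T
  z_zero : z 0 = P.z₀
  monotone : ∀ᵐ s ∂(lebesgueOn S), 0 ≤ t' s
  complementarity : ∀ᵐ s ∂(lebesgueOn S), t' s * P.stabilityDist lh s (z s) = 0
  normalization : ∀ᵐ s ∂(lebesgueOn S),
    t' s + P.R (z' s) + ‖z' s‖ * P.stabilityDist lh s (z s) = 1
  energy_identity : ∀ s₁ ∈ Icc 0 S, ∀ s₂ ∈ Icc 0 S,
    P.energy (z s₂) + ∫ r in s₁..s₂, (P.R (z' r) + ‖z' r‖ * P.stabilityDist lh r (z r)) =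
      P.energy (z s₁) + ∫ r in s₁..s₂, ⟪lh r, z' r⟫_ℝ
  compatibility : ∀ᵐ s, s ∈ increasePoints S t → lh s = l (t s)

/-- `(S, t, z, lh)` is a relaxed, normalized, `𝔭`-parametrized BV solution associated with the
load `l`. -/
def IsRelaxedSolution (P : RISystem d) (l : ℝ → EuclideanSpace ℝ (Fin d))
    (S : ℝ) (t : ℝ → ℝ) (z lh : ℝ → EuclideanSpace ℝ (Fin d)) : Prop :=
  ∃ (t' : ℝ → ℝ) (z' : ℝ → EuclideanSpace ℝ (Fin d)), P.IsRelaxedSolutionWith l S t z lh t' z'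

end RISystem

/-- The extension of a function on `[0, S]` beyond `S` by the constant `f S`. -/
def constExt {V : Type*} (S : ℝ) (f : ℝ → V) : ℝ → V := fun s => f (min s S)

end

/-!
# Compactness of the set of parametrized BV solutions

A function on `[0, S]` is extended to `ℝ` by constants to the left and to the right (`clampExt`), so
that the functions of a sequence with different lengths `S n` live on the same line. By the
normalization and the coercivity of `R`, the weak derivatives of `t n` and `z n` are bounded, so
these functions are Lipschitz with uniform constants
(`RISystem.StandingAssumptions.exists_isLipschitzSolution`). The work of the load, integrated by
parts, is at most linear in `sup ‖z n‖`, while the energy is at least quadratic; together with the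
energy identity, in which the dissipation equals the elapsed `s - t n s` by the normalization, this
bounds `z n` and `S n` (`RISystem.StandingAssumptions.exists_bound`).

Helly's theorem (`exists_subseq_tendsto_of_eVariationOn_le`) then gives a subsequence along which
`S n`, `t n`, `z n`, the loads `lh n` and the given loads `l n` converge, the functions at every
point. Pointwise convergence and uniform bounds imply all the weak* convergences:
`w1infWeakStar_of_tendsto` for Lipschitz functions and `bvWeakStar_of_tendsto` for functions of
bounded variation, whose derivative measures are the Stieltjes vector measures of their right
limits.

It remains to show that the limit is a relaxed solution
(`RISystem.StandingAssumptions.isRelaxedSolutionWith_of_tendsto`). Let `ξ = lh - DE(z)` be the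
driving force and `δ = dist(ξ, ∂R(0))`. Both converge boundedly and pointwise, hence strongly enough
to be paired with the weakly* convergent derivatives.
* The complementarity passes to the limit in the form `∫ t' δ = 0`.
* For `w ∈ ∂R(0)` and `‖e‖ ≤ 1` one has `⟨w + δ e, z'⟩ ≤ R(z') + ‖z'‖ δ = 1 - t'` along the
  sequence, so also `⟨w + δ e, z'⟩ ≤ 1 - t'` almost everywhere for the limit. The supremum over
  countably many pairs `(w, e)` gives `R(z') + ‖z'‖ δ ≤ 1 - t'`.
* The energy identity, with the dissipation replaced by `1 - t'`, passes to the limit, and by the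
  chain rule it says `1 - t' = ⟨ξ, z'⟩`. Since always `⟨ξ, z'⟩ ≤ R(z') + ‖z'‖ δ`, equality holds
  throughout: this is the normalization, and, integrated, the energy identity.
* The compatibility `lh s = l (t s)` is known for the sequence at almost all points with `t' > 0`,
  and such points exist arbitrarily close to an increase point of the limit. The subsequences
  selected by Helly's theorem are asymptotically equicontinuous off a countable set, which carries
  the condition over to all but countably many increase points
  (`RISystem.compatibility_of_tendsto`).
-/

/-! ### Functions of bounded variation and Helly's selection theorem -/

/-- The variation function `x ↦ Var(f; (-∞, x])` is a bounded monotone function which controls the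
increments of `f`. -/
lemma exists_monotone_dist_le {E : Type*} [PseudoMetricSpace E] {f : ℝ → E} {K : ℝ≥0}
    (hf : eVariationOn f univ ≤ K) :
    ∃ W : ℝ → ℝ, Monotone W ∧ (∀ x, W x ∈ Icc (0 : ℝ) K) ∧
      ∀ x y, x ≤ y → dist (f x) (f y) ≤ W y - W x := by
  have hfin (s : Set ℝ) : eVariationOn f s ≠ ∞ :=
    ((eVariationOn.mono f (subset_univ s)).trans hf).trans_lt ENNReal.coe_lt_top |>.ne
  refine ⟨fun x => (eVariationOn f (Iic x)).toReal, fun x y hxy => ?_, fun x => ⟨by positivity, ?_⟩,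
    fun x y hxy => ?_⟩
  · exact ENNReal.toReal_mono (hfin _) (eVariationOn.mono f (Iic_subset_Iic.2 hxy))
  · exact ENNReal.toReal_mono ENNReal.coe_ne_top ((eVariationOn.mono f (subset_univ _)).trans hf)
  · have h1 : eVariationOn f (Iic x) + eVariationOn f (Icc x y) ≤ eVariationOn f (Iic y) :=
      (eVariationOn.add_le_union f fun u hu v hv => hu.trans hv.1).trans
        (eVariationOn.mono f (union_subset (Iic_subset_Iic.2 hxy) Icc_subset_Iic_self))
    have h2 : edist (f x) (f y) ≤ eVariationOn f (Icc x y) :=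
      eVariationOn.edist_le f (left_mem_Icc.2 hxy) (right_mem_Icc.2 hxy)
    have h3 := ENNReal.toReal_mono (hfin _) ((add_le_add le_rfl h2).trans h1)
    rw [ENNReal.toReal_add (hfin _) (edist_ne_top _ _), ← dist_edist] at h3
    linarith

/-- Diagonal extraction: a bounded sequence of functions has a subsequence that converges at every
point of a given countable set. -/
lemma exists_subseq_tendsto_of_countable {α E : Type*} [PseudoMetricSpace E] [ProperSpace E]
    {D : Set α} (hD : D.Countable) {f : ℕ → α → E} {K : Set E} (hK : IsCompact K)
    (hf : ∀ n x, f n x ∈ K) :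
    ∃ k : ℕ → ℕ, StrictMono k ∧ ∃ g : α → E, ∀ x ∈ D,
      Tendsto (fun n => f (k n) x) atTop (𝓝 (g x)) := by
  have : Countable D := hD
  have hc : IsCompact (Set.pi univ fun _ : D => K) := isCompact_univ_pi fun _ => hK
  obtain ⟨a, -, k, hk, hlim⟩ := hc.isSeqCompact (x := fun n (x : D) => f n x)
    (fun n x _ => hf n x)
  rw [tendsto_pi_nhds] at hlim
  classical
  refine ⟨k, hk, fun x => if hx : x ∈ D then a ⟨x, hx⟩ else f 0 x, fun x hx => ?_⟩
  simpa [hx] using hlim ⟨x, hx⟩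

/-- **Helly's selection theorem**. Besides the pointwise convergence, the selected subsequence is
asymptotically equicontinuous at every point outside of a countable set, namely at the continuity
points of a limit of the variation functions. -/
theorem exists_subseq_tendsto_of_eVariationOn_le {E : Type*} [NormedAddCommGroup E] [ProperSpace E]
    {f : ℕ → ℝ → E} {K : ℝ≥0} {B : ℝ} (hvar : ∀ n, eVariationOn (f n) univ ≤ K)
    (hbd : ∀ n x, ‖f n x‖ ≤ B) :
    ∃ k : ℕ → ℕ, StrictMono k ∧ ∃ g : ℝ → E,
      (∀ x, Tendsto (fun n => f (k n) x) atTop (𝓝 (g x))) ∧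
      ∃ D : Set ℝ, D.Countable ∧ ∀ x ∉ D, ∀ ε > 0, ∃ δ > 0, ∀ᶠ n in atTop,
        ∀ y, |y - x| < δ → ‖f (k n) y - f (k n) x‖ < ε := by
  choose V hVmono hVmem hVdist using fun n => exists_monotone_dist_le (hvar n)
  -- The variation functions converge at the rational points along a subsequence.
  obtain ⟨k₁, hk₁, v, hv⟩ := exists_subseq_tendsto_of_countable
    (countable_range ((↑) : ℚ → ℝ)) isCompact_Icc hVmem
  have hvmem : ∀ x ∈ range ((↑) : ℚ → ℝ), v x ∈ Icc (0 : ℝ) K := fun x hx =>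
    isClosed_Icc.mem_of_tendsto (hv x hx) (.of_forall fun n => hVmem _ _)
  obtain ⟨W, hW, hWv⟩ := MonotoneOn.exists_monotone_extension (f := v)
    (s := range ((↑) : ℚ → ℝ))
    (fun x hx y hy hxy => le_of_tendsto_of_tendsto' (hv x hx) (hv y hy) fun n => hVmono _ hxy)
    ⟨0, by rintro _ ⟨x, hx, rfl⟩; exact (hvmem x hx).1⟩
    ⟨K, by rintro _ ⟨x, hx, rfl⟩; exact (hvmem x hx).2⟩
  have hWlim (q : ℚ) : Tendsto (fun n => V (k₁ n) q) atTop (𝓝 (W q)) := by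
    rw [← hWv ⟨q, rfl⟩]; exact hv _ ⟨q, rfl⟩
  set D : Set ℝ := {x | ¬ ContinuousAt W x} with hDdef
  have hD : D.Countable := hW.countable_not_continuousAt
  obtain ⟨k₂, hk₂, a, ha⟩ := exists_subseq_tendsto_of_countable
    (hD.union (countable_range ((↑) : ℚ → ℝ))) (isCompact_closedBall (0 : E) B)
    (f := fun n => f (k₁ n)) (fun n x => by simpa using hbd (k₁ n) x)
  have hequi : ∀ x ∉ D, ∀ ε > 0, ∃ δ > 0, ∀ᶠ n in atTop,
      ∀ y, |y - x| < δ → ‖f (k₁ (k₂ n)) y - f (k₁ (k₂ n)) x‖ < ε := by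
    intro x hx ε hε
    have hcont : ContinuousAt W x := by simpa [hDdef] using hx
    obtain ⟨δ, hδ, hδW⟩ := Metric.continuousAt_iff.1 hcont (ε / 2) (by positivity)
    obtain ⟨p, hp₁, hp₂⟩ := exists_rat_btwn (show x - δ < x by linarith)
    obtain ⟨q, hq₁, hq₂⟩ := exists_rat_btwn (show x < x + δ by linarith)
    have hpq : W q - W p < ε := by
      have h1 := hδW (show dist (p : ℝ) x < δ by
        rw [Real.dist_eq, abs_lt]; constructor <;> linarith)
      have h2 := hδW (show dist (q : ℝ) x < δ by
        rw [Real.dist_eq, abs_lt]; constructor <;> linarith)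
      rw [Real.dist_eq, abs_lt] at h1 h2
      linarith [h1.1, h2.2]
    refine ⟨min (x - p) (q - x), lt_min (by linarith) (by linarith), ?_⟩
    have hlim : Tendsto (fun n => V (k₁ (k₂ n)) q - V (k₁ (k₂ n)) p) atTop (𝓝 (W q - W p)) :=
      ((hWlim q).comp hk₂.tendsto_atTop).sub ((hWlim p).comp hk₂.tendsto_atTop)
    filter_upwards [hlim.eventually_lt_const hpq] with n hn y hy
    rw [lt_min_iff, abs_lt, abs_lt] at hy
    refine lt_of_le_of_lt ?_ hn
    have m := hVmono (k₁ (k₂ n))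
    rcases le_total x y with hxy | hxy
    · have h1 := hVdist (k₁ (k₂ n)) x y hxy
      rw [dist_comm, dist_eq_norm] at h1
      linarith [m hp₂.le, m (show y ≤ q by linarith [hy.2.2])]
    · have h1 := hVdist (k₁ (k₂ n)) y x hxy
      rw [dist_eq_norm] at h1
      linarith [m hq₁.le, m (show (p : ℝ) ≤ y by linarith [hy.1.1])]
  have hconv : ∀ x, ∃ y, Tendsto (fun n => f (k₁ (k₂ n)) x) atTop (𝓝 y) := by
    intro x
    by_cases hx : x ∈ D
    · exact ⟨a x, ha x (.inl hx)⟩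
    refine cauchySeq_tendsto_of_complete (Metric.cauchySeq_iff'.2 fun ε hε => ?_)
    obtain ⟨δ, hδ, hev⟩ := hequi x hx (ε / 4) (by positivity)
    obtain ⟨q, hq₁, hq₂⟩ := exists_rat_btwn (show x < x + δ by linarith)
    have hq : |(q : ℝ) - x| < δ := by rw [abs_lt]; constructor <;> linarith
    obtain ⟨N₁, hN₁⟩ := eventually_atTop.1 hev
    obtain ⟨N₂, hN₂⟩ := Metric.cauchySeq_iff.1 (ha q (.inr ⟨q, rfl⟩)).cauchySeq (ε / 4)
      (by positivity)
    refine ⟨max N₁ N₂, fun n hn => ?_⟩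
    have h1 := hN₁ n ((le_max_left _ _).trans hn) q hq
    have h2 := hN₁ (max N₁ N₂) (le_max_left _ _) q hq
    have h3 := hN₂ n ((le_max_right _ _).trans hn) (max N₁ N₂) (le_max_right _ _)
    rw [← dist_eq_norm] at h1 h2
    have h4 := dist_triangle4 (f (k₁ (k₂ n)) x) (f (k₁ (k₂ n)) q)
      (f (k₁ (k₂ (max N₁ N₂))) q) (f (k₁ (k₂ (max N₁ N₂))) x)
    rw [dist_comm] at h1
    linarith
  choose g hg using hconv
  exact ⟨k₁ ∘ k₂, hk₁.comp hk₂, g, hg, D, hD, hequi⟩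

/-- The variation is lower semicontinuous under pointwise convergence. -/
lemma eVariationOn_le_of_tendsto {E : Type*} [PseudoEMetricSpace E] {f : ℕ → ℝ → E} {g : ℝ → E}
    {s : Set ℝ} {K : ℝ≥0∞} (h : ∀ x ∈ s, Tendsto (fun n => f n x) atTop (𝓝 (g x)))
    (hf : ∀ n, eVariationOn (f n) s ≤ K) : eVariationOn g s ≤ K := by
  by_contra! hlt
  obtain ⟨n, hn⟩ := (eVariationOn.lowerSemicontinuous_aux h hlt).exists
  exact (hf n).not_gt hn

/-- A function of bounded variation is measurable. -/
lemma BoundedVariationOn.stronglyMeasurable {V : Type*} [NormedAddCommGroup V]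
    [InnerProductSpace ℝ V] [FiniteDimensional ℝ V] {f : ℝ → V} (hf : BoundedVariationOn f univ) :
    StronglyMeasurable f := by
  let b := stdOrthonormalBasis ℝ V
  have key (i) : StronglyMeasurable fun x => ⟪b i, f x⟫_ℝ := by
    have : BoundedVariationOn ((innerSL ℝ (b i)) ∘ f) univ :=
      (innerSL ℝ (b i)).lipschitz.comp_boundedVariationOn hf
    obtain ⟨p, q, hp, hq, h⟩ := this.locallyBoundedVariationOn.exists_monotoneOn_sub_monotoneOn
    have : (fun x => ⟪b i, f x⟫_ℝ) = p - q := h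
    rw [this]
    exact ((monotoneOn_univ.1 hp).measurable.sub
      (monotoneOn_univ.1 hq).measurable).stronglyMeasurable
  have : f = fun x => ∑ i, ⟪b i, f x⟫_ℝ • b i := by
    ext1 x; exact (b.sum_repr' (f x)).symm
  rw [this]
  exact Finset.stronglyMeasurable_fun_sum _ fun i _ => (key i).smul_const _

/-- If the increments of `H` over short intervals are dominated, up to a quadratically small error,
by `M` times those of a monotone function, then so are the increments over long intervals. -/
lemma norm_sub_le_of_norm_increment_le {E : Type*} [SeminormedAddCommGroup E] {H : ℝ → E}
    {W : ℝ → ℝ} {a b M C : ℝ} (hab : a ≤ b)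
    (h : ∀ x ∈ Icc a b, ∀ y ∈ Icc a b, x ≤ y →
      ‖H y - H x‖ ≤ (M + C * (y - x)) * (W y - W x)) :
    ‖H b - H a‖ ≤ M * (W b - W a) := by
  have key : ∀ N : ℕ, ‖H b - H a‖ ≤ (M + C * ((b - a) / ((N : ℝ) + 1))) * (W b - W a) := by
    intro N
    set u : ℕ → ℝ := fun i => a + i * ((b - a) / ((N : ℝ) + 1)) with hu
    have hstep : 0 ≤ (b - a) / ((N : ℝ) + 1) := div_nonneg (by linarith) (by positivity)
    have hN : (N : ℝ) + 1 ≠ 0 := by positivity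
    have hu0 : u 0 = a := by simp [hu]
    have huN : u (N + 1) = b := by simp only [hu]; push_cast; field_simp; ring
    have hmono : Monotone u := monotone_nat_of_le_succ fun i => by
      simp only [hu]; push_cast; nlinarith
    have hmem : ∀ i ≤ N + 1, u i ∈ Icc a b := fun i hi =>
      ⟨hu0 ▸ hmono (Nat.zero_le i), huN ▸ hmono hi⟩
    have h1 := Finset.sum_range_sub (fun i => H (u i)) (N + 1)
    have h2 := Finset.sum_range_sub (fun i => W (u i)) (N + 1)
    rw [hu0, huN] at h1 h2
    rw [← h1, ← h2, Finset.mul_sum]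
    refine (norm_sum_le _ _).trans (Finset.sum_le_sum fun i hi => ?_)
    have hi : i < N + 1 := Finset.mem_range.1 hi
    have h3 := h (u i) (hmem i hi.le) (u (i + 1)) (hmem _ hi) (hmono i.le_succ)
    have h4 : u (i + 1) - u i = (b - a) / ((N : ℝ) + 1) := by simp only [hu]; push_cast; ring
    rwa [h4] at h3
  have hlim : Tendsto (fun N : ℕ => (M + C * ((b - a) / ((N : ℝ) + 1))) * (W b - W a)) atTop
      (𝓝 ((M + C * 0) * (W b - W a))) := by
    refine ((tendsto_const_nhds.add (tendsto_const_nhds.mul ?_))).mul_const _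
    have := (tendsto_one_div_add_atTop_nhds_zero_nat (𝕜 := ℝ)).const_mul (b - a)
    simpa [div_eq_mul_inv] using this
  simpa using ge_of_tendsto' hlim key

/-! ### The derivative measure of a function of bounded variation -/

/-- The Stieltjes vector measure of `f`, together with a dominating measure whose mass is bounded by
the variation of `f`. -/
lemma exists_vectorMeasure_Ioc_eq {E : Type*} [NormedAddCommGroup E] [CompleteSpace E] {f : ℝ → E}
    {K : ℝ≥0} (hf : eVariationOn f univ ≤ K) :
    ∃ (μ : VectorMeasure ℝ E) (m : Measure ℝ), IsFiniteMeasure m ∧ (∀ s, ‖μ s‖ₑ ≤ m s) ∧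
      (∀ a b, m (Ioc a b) ≤ K) ∧
      ∀ a b, a ≤ b → μ (Ioc a b) = f.rightLim b - f.rightLim a := by
  have hbv : BoundedVariationOn f univ := (hf.trans_lt ENNReal.coe_lt_top).ne
  have hrle : eVariationOn f.rightLim univ ≤ K :=
    (eVariationOn.eVariationOn_rightLim_le isOpen_univ).trans hf
  have hloc := hbv.rightLim.locallyBoundedVariationOn
  set m := (hbv.stieltjesFunctionRightLim 0).measure with hm
  have hIoc : ∀ a b, a ≤ b → m (Ioc a b) = eVariationOn f.rightLim (Icc a b) := by
    intro a b hab
    rw [hm, StieltjesFunction.measure_Ioc, BoundedVariationOn.stieltjesFunctionRightLim_apply,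
      BoundedVariationOn.stieltjesFunctionRightLim_apply,
      ← variationOnFromTo.add hloc (mem_univ 0) (mem_univ a) (mem_univ b), add_sub_cancel_left,
      variationOnFromTo.eq_of_le _ _ hab, univ_inter, ENNReal.ofReal_toReal]
    exact ((eVariationOn.mono _ (subset_univ _)).trans_lt hbv.rightLim.lt_top).ne
  have hfin : IsFiniteMeasure m := StieltjesFunction.isFiniteMeasure_of_forall_abs_le
    (C := (eVariationOn f.rightLim univ).toReal) _
    fun x => variationOnFromTo.abs_le_eVariationOn hbv.rightLim
  have hle : ∀ s ∈ {s | ∃ u v, u ≤ v ∧ s = Ioc u v}, ‖AddContent.onIoc f.rightLim s‖ₑ ≤ m s := by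
    rintro s ⟨u, v, huv, rfl⟩
    rw [AddContent.onIoc_apply huv, hIoc u v huv, ← edist_eq_enorm_sub]
    exact eVariationOn.edist_le _ (right_mem_Icc.2 huv) (left_mem_Icc.2 huv)
  have hgen : (inferInstance : MeasurableSpace ℝ) =
      MeasurableSpace.generateFrom {s | ∃ u v : ℝ, u ≤ v ∧ s = Ioc u v} := by
    rw [BorelSpace.measurable_eq (α := ℝ)]
    convert! borel_eq_generateFrom_Ioc_le ℝ using 2
    grind only
  obtain ⟨μ, hμ, hμm⟩ :=
    VectorMeasure.exists_extension_of_isSetSemiring_of_le_measure_of_generateFrom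
      IsSetSemiring.Ioc hle hgen
  refine ⟨μ, m, hfin, hμm, fun a b => ?_, fun a b hab => ?_⟩
  · rcases le_total a b with hab | hab
    · rw [hIoc a b hab]
      exact (eVariationOn.mono _ (subset_univ _)).trans hrle
    · simp [Ioc_eq_empty_of_le hab]
  · rw [hμ _ ⟨a, b, hab, rfl⟩, AddContent.onIoc_apply hab]

lemma BoundedVariationOn.rightLim_ae_eq {V : Type*} [NormedAddCommGroup V] [NormedSpace ℝ V]
    [FiniteDimensional ℝ V] {f : ℝ → V} (hf : BoundedVariationOn f univ) :
    f.rightLim =ᵐ[volume] f := by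
  filter_upwards [hf.locallyBoundedVariationOn.ae_differentiableAt] with x hx
  exact hx.continuousAt.continuousWithinAt.rightLim_eq

lemma IsTestFunction.eq_zero_of_notMem {S : ℝ} {φ : ℝ → ℝ} (hφ : IsTestFunction S φ) {x : ℝ}
    (hx : x ∉ Ioo 0 S) : φ x = 0 :=
  image_eq_zero_of_notMem_tsupport fun h => hx (hφ.supp h)

lemma IsTestFunction.exists_lipschitzWith {S : ℝ} {φ : ℝ → ℝ} (hφ : IsTestFunction S φ) :
    ∃ L, LipschitzWith L φ :=
  ContDiff.lipschitzWith_of_hasCompactSupport hφ.compact hφ.smooth (by simp)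

lemma IsTestFunction.hasDerivAt {S : ℝ} {φ : ℝ → ℝ} (hφ : IsTestFunction S φ) (x : ℝ) :
    HasDerivAt φ (deriv φ x) x :=
  (hφ.smooth.differentiable (by simp) x).hasDerivAt

lemma IsTestFunction.continuous_deriv {S : ℝ} {φ : ℝ → ℝ} (hφ : IsTestFunction S φ) :
    Continuous (deriv φ) :=
  hφ.smooth.continuous_deriv (by simp)

/-- Integration by parts against the Stieltjes vector measure of `f`. Over a short interval
`(x, y]` both integrals agree up to an error `O(y - x)` times the mass of `(x, y]`, and such errors
sum up to zero. -/
lemma setIntegral_Ioc_eq_neg_integral_deriv {V : Type*} [NormedAddCommGroup V] [NormedSpace ℝ V]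
    [CompleteSpace V] {g : ℝ → V} {μ : VectorMeasure ℝ V} {m : Measure ℝ}
    [IsFiniteMeasure m] (hm : ∀ s, ‖μ s‖ₑ ≤ m s)
    (hμ : ∀ a b, a ≤ b → μ (Ioc a b) = g b - g a)
    (hg : ∀ a b, IntervalIntegrable g volume a b)
    {S : ℝ} (hS : 0 ≤ S) {φ : ℝ → ℝ} (hφ : IsTestFunction S φ) :
    vmIntegral (μ.restrict (Ioc 0 S)) φ = - ∫ s in (0 : ℝ)..S, deriv φ s • g s := by
  have hvar : μ.variation ≤ m := VectorMeasure.variation_le_of_forall_enorm_le fun s _ => hm s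
  have hfin : IsFiniteMeasure μ.variation := isFiniteMeasure_of_le m hvar
  obtain ⟨L, hL⟩ := hφ.exists_lipschitzWith
  have hint (s : Set ℝ) : μ.IntegrableOn φ s := by
    have h1 : Integrable φ μ.variation := hφ.smooth.continuous.integrable_of_hasCompactSupport
      hφ.compact
    exact VectorMeasure.Integrable.restrict (μ := μ) h1
  have hint' (a b : ℝ) : IntervalIntegrable (fun s => deriv φ s • g s) volume a b :=
    (hg a b).continuousOn_smul hφ.continuous_deriv.continuousOn
  have hint'' (a b : ℝ) : IntervalIntegrable (fun s => deriv φ s) volume a b :=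
    hφ.continuous_deriv.intervalIntegrable a b
  have hginc : ∀ x y, x ≤ y → ‖g y - g x‖ ≤ m.real (Ioc x y) := by
    intro x y hxy
    rw [← hμ x y hxy]
    exact (ENNReal.toReal_mono (measure_ne_top m _) (hm _)).trans' (by simp)
  set H : ℝ → V := fun x => vmIntegral (μ.restrict (Ioc 0 x)) φ - φ x • g x +
    ∫ s in (0 : ℝ)..x, deriv φ s • g s with hH
  have key : ‖H S - H 0‖ ≤ 0 * (m.real (Ioc 0 S) - m.real (Ioc 0 0)) := by
    refine norm_sub_le_of_norm_increment_le (W := fun x => m.real (Ioc 0 x)) (C := 2 * L) hS ?_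
    intro x hx y hy hxy
    have hW : m.real (Ioc 0 y) - m.real (Ioc 0 x) = m.real (Ioc x y) := by
      rw [← Ioc_union_Ioc_eq_Ioc hx.1 hxy, measureReal_union (Ioc_disjoint_Ioc_of_le le_rfl)
        measurableSet_Ioc, add_sub_cancel_left]
    have hI : vmIntegral (μ.restrict (Ioc 0 y)) φ = vmIntegral (μ.restrict (Ioc 0 x)) φ +
        vmIntegral (μ.restrict (Ioc x y)) φ := by
      unfold vmIntegral
      rw [← Ioc_union_Ioc_eq_Ioc hx.1 hxy]
      exact VectorMeasure.setIntegral_union (Ioc_disjoint_Ioc_of_le le_rfl) measurableSet_Ioc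
        measurableSet_Ioc (hint _) (hint _)
    have hJ : ∫ s in (0 : ℝ)..y, deriv φ s • g s = (∫ s in (0 : ℝ)..x, deriv φ s • g s) +
        ∫ s in x..y, deriv φ s • g s :=
      (intervalIntegral.integral_add_adjacent_intervals (hint' _ _) (hint' _ _)).symm
    have hc : IsFiniteMeasure (μ.restrict (Ioc x y)).variation := by
      rw [VectorMeasure.variation_restrict measurableSet_Ioc]; infer_instance
    have hA : vmIntegral (μ.restrict (Ioc x y)) φ - φ y • (g y - g x) =
        vmIntegral (μ.restrict (Ioc x y)) (fun s => φ s - φ y) := by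
      unfold vmIntegral
      rw [VectorMeasure.integral_fun_sub (hint _) (integrable_const _),
        VectorMeasure.setIntegral_const, hμ x y hxy]
      rfl
    have hB : (∫ s in x..y, deriv φ s • g s) - (φ y - φ x) • g x =
        ∫ s in x..y, deriv φ s • (g s - g x) := by
      simp_rw [smul_sub]
      rw [intervalIntegral.integral_sub (hint' _ _)
          ⟨(hint'' x y).1.smul_const _, (hint'' x y).2.smul_const _⟩,
        intervalIntegral.integral_smul_const,
        intervalIntegral.integral_deriv_eq_sub (fun s _ => (hφ.hasDerivAt s).differentiableAt)
          (hint'' _ _)]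
    have hinc : H y - H x = vmIntegral (μ.restrict (Ioc x y)) (fun s => φ s - φ y) +
        ∫ s in x..y, deriv φ s • (g s - g x) := by
      rw [← hA, ← hB]
      simp only [hH, hI, hJ, smul_sub, sub_smul]
      abel
    have hA' : ‖vmIntegral (μ.restrict (Ioc x y)) (fun s => φ s - φ y)‖ ≤
        L * (y - x) * m.real (Ioc x y) := by
      have h1 := VectorMeasure.norm_setIntegral_le_of_norm_le_const (μ := μ) (s := Ioc x y)
        (B := ContinuousLinearMap.lsmul ℝ ℝ) (f := fun s => φ s - φ y) (C := L * (y - x))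
        (fun s hs => by
          refine (hL.norm_sub_le s y).trans ?_
          gcongr
          rw [Real.norm_eq_abs, abs_le]
          constructor <;> linarith [hs.1, hs.2])
      refine h1.trans ?_
      have h2 : ‖(ContinuousLinearMap.lsmul ℝ ℝ : ℝ →L[ℝ] V →L[ℝ] V)‖ ≤ 1 :=
        ContinuousLinearMap.opNorm_lsmul_le
      have h3 : μ.variation.real (Ioc x y) ≤ m.real (Ioc x y) :=
        ENNReal.toReal_mono (measure_ne_top m _) (hvar _)
      have h4 : 0 ≤ L * (y - x) := mul_nonneg L.2 (sub_nonneg.2 hxy)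
      calc _ ≤ L * (y - x) * 1 * m.real (Ioc x y) := by gcongr
        _ = _ := by ring
    have hB' : ‖∫ s in x..y, deriv φ s • (g s - g x)‖ ≤ L * m.real (Ioc x y) * |y - x| := by
      refine intervalIntegral.norm_integral_le_of_norm_le_const fun s hs => ?_
      rw [uIoc_of_le hxy] at hs
      rw [norm_smul]
      refine mul_le_mul (norm_deriv_le_of_lipschitz hL) ((hginc x s hs.1.le).trans ?_)
        (norm_nonneg _) L.2
      exact measureReal_mono (Ioc_subset_Ioc_right hs.2)
    rw [abs_of_nonneg (sub_nonneg.2 hxy)] at hB'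
    rw [hW, hinc]
    refine (norm_add_le _ _).trans ((add_le_add hA' hB').trans_eq ?_)
    ring
  rw [zero_mul, norm_le_zero_iff, sub_eq_zero] at key
  have h0 : φ 0 = 0 := hφ.eq_zero_of_notMem (by simp)
  have hS0 : φ S = 0 := hφ.eq_zero_of_notMem (by simp)
  have hz : vmIntegral (μ.restrict (Ioc (0 : ℝ) 0)) φ = 0 := by
    simp [vmIntegral]
  simp only [hH, h0, hS0, hz, zero_smul, intervalIntegral.integral_same] at key
  rw [eq_neg_iff_add_eq_zero]
  simpa using key

instance (S : ℝ) : IsFiniteMeasure (lebesgueOn S) := by unfold lebesgueOn; infer_instance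

/-- A function of bounded variation has a derivative measure on `(0, S)`, whose total variation is
bounded by the variation of the function. -/
lemma exists_hasDerivMeasure {V : Type*} [NormedAddCommGroup V] [InnerProductSpace ℝ V]
    [FiniteDimensional ℝ V] {f : ℝ → V} {K : ℝ≥0} {B : ℝ} (hf : eVariationOn f univ ≤ K)
    (hB : ∀ x, ‖f x‖ ≤ B) {S : ℝ} (hS : 0 ≤ S) :
    ∃ μ : VectorMeasure ℝ V, HasDerivMeasure S f μ ∧ μ.variation univ ≤ K := by
  have hbv : BoundedVariationOn f univ := (hf.trans_lt ENNReal.coe_lt_top).ne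
  obtain ⟨μ, m, hfin, hμm, hmK, hμ⟩ := exists_vectorMeasure_Ioc_eq hf
  have hvar : (μ.restrict (Ioo 0 S)).variation ≤ m.restrict (Ioo 0 S) := by
    rw [VectorMeasure.variation_restrict measurableSet_Ioo]
    exact Measure.restrict_mono subset_rfl
      (VectorMeasure.variation_le_of_forall_enorm_le fun s _ => hμm s)
  have hbd : ∀ᵐ x ∂(volume : Measure ℝ), ‖f.rightLim x‖ ≤ B := by
    filter_upwards [hbv.rightLim_ae_eq] with x hx
    rw [hx]; exact hB x
  have hfi (a b : ℝ) : IntervalIntegrable f.rightLim volume a b := by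
    rw [intervalIntegrable_iff]
    exact IntegrableOn.of_bound (by simp) hbv.rightLim.stronglyMeasurable.aestronglyMeasurable B
      (ae_restrict_of_ae hbd)
  refine ⟨μ.restrict (Ioo 0 S), ⟨?_, ?_, isFiniteMeasure_of_le _ hvar, fun φ hφ => ?_⟩, ?_⟩
  · exact MemLp.of_bound hbv.stronglyMeasurable.aestronglyMeasurable B (.of_forall hB)
  · ext s hs
    rw [VectorMeasure.restrict_apply _ measurableSet_Ioo hs,
      VectorMeasure.restrict_apply _ measurableSet_Ioo (hs.inter measurableSet_Ioo),
      VectorMeasure.restrict_apply _ measurableSet_Ioo hs, inter_assoc, inter_self]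
  · have h1 : vmIntegral (μ.restrict (Ioo 0 S)) φ = vmIntegral (μ.restrict (Ioc 0 S)) φ := by
      refine (VectorMeasure.setIntegral_eq_of_subset_of_forall_sdiff_eq_zero measurableSet_Ioo
        measurableSet_Ioc Ioo_subset_Ioc_self fun x hx => ?_).symm
      exact hφ.eq_zero_of_notMem hx.2
    rw [h1, setIntegral_Ioc_eq_neg_integral_deriv hμm hμ hfi hS hφ, neg_neg,
      intervalIntegral.integral_of_le hS, integral_Ioc_eq_integral_Ioo]
    refine integral_congr_ae (ae_restrict_of_ae ?_)
    filter_upwards [hbv.rightLim_ae_eq] with x hx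
    rw [hx]
  · refine (hvar univ).trans ?_
    rw [Measure.restrict_apply_univ]
    exact (measure_mono Ioo_subset_Ioc_self).trans (hmK 0 S)

/-- Test functions are uniformly dense in `C₀((0, S))`. -/
lemma exists_isTestFunction_abs_sub_le {S : ℝ} {φ : ℝ → ℝ} (hφ : Continuous φ)
    (hφ0 : ∀ s, s ∉ Ioo 0 S → φ s = 0) {ε : ℝ} (hε : 0 < ε) :
    ∃ ψ, IsTestFunction S ψ ∧ ∀ x, |φ x - ψ x| ≤ ε := by
  -- The truncation of `φ` at height `ε / 2` is supported in the compact set `{ε / 2 ≤ |φ|}`.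
  set χ : ℝ → ℝ := fun x => φ x - max (-(ε / 2)) (min (φ x) (ε / 2)) with hχ
  have hχc : Continuous χ := by fun_prop
  have hsupp : Function.support χ ⊆ {x | ε / 2 ≤ |φ x|} := by
    intro x hx
    by_contra h
    rw [mem_ofPred_eq, not_le, abs_lt] at h
    refine hx ?_
    simp only [hχ]
    rw [min_eq_left h.2.le, max_eq_right h.1.le, sub_self]
  have hclosed : IsClosed {x | ε / 2 ≤ |φ x|} := isClosed_le continuous_const hφ.abs
  have hsub : {x | ε / 2 ≤ |φ x|} ⊆ Ioo 0 S := by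
    intro x hx
    by_contra h
    rw [mem_ofPred_eq, hφ0 x h, abs_zero] at hx
    linarith
  obtain ⟨ψ, hψ, hψχ, hψs⟩ := hχc.exists_contDiff_approx ⊤ (ε := fun _ => ε / 2)
    continuous_const (fun _ => by positivity)
  have hts : tsupport ψ ⊆ {x | ε / 2 ≤ |φ x|} :=
    closure_minimal (hψs.trans hsupp) hclosed
  refine ⟨ψ, ⟨hψ, ?_, hts.trans hsub⟩, fun x => ?_⟩
  · exact isCompact_Icc.of_isClosed_subset (isClosed_tsupport ψ)
      ((hts.trans hsub).trans Ioo_subset_Icc_self)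
  · have h1 : |φ x - χ x| ≤ ε / 2 := by
      simp only [hχ, sub_sub_cancel]
      rw [abs_le]
      exact ⟨le_max_left _ _, max_le (by linarith) (min_le_right _ _)⟩
    have h2 := (hψχ x).le
    rw [dist_comm, Real.dist_eq] at h2
    have := abs_sub_le (φ x) (χ x) (ψ x)
    linarith

lemma norm_vmIntegral_sub_le {V : Type*} [NormedAddCommGroup V] [NormedSpace ℝ V] [CompleteSpace V]
    {μ : VectorMeasure ℝ V} {K : ℝ≥0} (hμ : μ.variation univ ≤ K) {φ ψ : ℝ → ℝ}
    (hφ : Integrable φ μ.variation) (hψ : Integrable ψ μ.variation) {ε : ℝ}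
    (h : ∀ x, |φ x - ψ x| ≤ ε) :
    ‖vmIntegral μ φ - vmIntegral μ ψ‖ ≤ ε * K := by
  have hfin : IsFiniteMeasure μ.variation := ⟨hμ.trans_lt ENNReal.coe_lt_top⟩
  have hε : 0 ≤ ε := (abs_nonneg _).trans (h 0)
  unfold vmIntegral
  rw [← VectorMeasure.integral_fun_sub hφ hψ]
  refine (VectorMeasure.norm_integral_le_of_norm_le_const (C := ε) (.of_forall h)).trans ?_
  have h2 : ‖(ContinuousLinearMap.lsmul ℝ ℝ : ℝ →L[ℝ] V →L[ℝ] V)‖ ≤ 1 :=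
    ContinuousLinearMap.opNorm_lsmul_le
  have h3 : μ.variation.real univ ≤ K := ENNReal.toReal_mono ENNReal.coe_ne_top hμ
  calc _ ≤ ε * 1 * K := by gcongr
    _ = _ := by ring

/-- Pointwise convergence together with a bound in `BV` implies weak* convergence in `BV`. -/
lemma bvWeakStar_of_tendsto {V : Type*} [NormedAddCommGroup V] [InnerProductSpace ℝ V]
    [FiniteDimensional ℝ V] {f : ℕ → ℝ → V} {g : ℝ → V} {K : ℝ≥0} {B : ℝ}
    (hvar : ∀ n, eVariationOn (f n) univ ≤ K) (hB : ∀ n x, ‖f n x‖ ≤ B)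
    (hlim : ∀ x, Tendsto (fun n => f n x) atTop (𝓝 (g x))) {S : ℝ} (hS : 0 ≤ S) :
    BVWeakStar S f g := by
  have hgvar : eVariationOn g univ ≤ K := eVariationOn_le_of_tendsto (fun x _ => hlim x) hvar
  have hgB : ∀ x, ‖g x‖ ≤ B := fun x => le_of_tendsto' (hlim x).norm fun n => hB n x
  have hfm (n : ℕ) : StronglyMeasurable (f n) :=
    BoundedVariationOn.stronglyMeasurable ((hvar n).trans_lt ENNReal.coe_lt_top).ne
  have hgm : StronglyMeasurable g :=
    BoundedVariationOn.stronglyMeasurable (hgvar.trans_lt ENNReal.coe_lt_top).ne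
  choose μ hμ hμK using fun n => exists_hasDerivMeasure (hvar n) (hB n) hS
  obtain ⟨ν, hν, hνK⟩ := exists_hasDerivMeasure hgvar hgB hS
  refine ⟨?_, μ, ν, hμ, hν, fun φ hφ hφ0 => ?_⟩
  · have h1 := tendsto_lintegral_norm_of_dominated_convergence (μ := lebesgueOn S)
      (F := f) (f := g) (bound := fun _ => B) (fun n => (hfm n).aestronglyMeasurable)
      (integrable_const B).hasFiniteIntegral (fun n => .of_forall (hB n)) (.of_forall hlim)
    refine h1.congr fun n => ?_
    rw [eLpNorm_one_eq_lintegral_enorm]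
    simp [ofReal_norm]
  · have hconv (ψ) (hψ : IsTestFunction S ψ) :
        Tendsto (fun n => vmIntegral (μ n) ψ) atTop (𝓝 (vmIntegral ν ψ)) := by
      have h1 : Tendsto (fun n => ∫ s, deriv ψ s • f n s ∂(lebesgueOn S)) atTop
          (𝓝 (∫ s, deriv ψ s • g s ∂(lebesgueOn S))) := by
        obtain ⟨L, hL⟩ := hψ.exists_lipschitzWith
        refine tendsto_integral_of_dominated_convergence (fun _ => L * B)
          (fun n => hψ.continuous_deriv.aestronglyMeasurable.smul (hfm n).aestronglyMeasurable)
          (integrable_const _) (fun n => .of_forall fun s => ?_)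
          (.of_forall fun s => (hlim s).const_smul _)
        rw [norm_smul]
        exact mul_le_mul (norm_deriv_le_of_lipschitz hL) (hB n s) (norm_nonneg _) L.2
      have h2 := h1.neg
      simp_rw [(hμ _).weak_deriv ψ hψ, hν.weak_deriv ψ hψ, neg_neg] at h2
      exact h2
    have hφi (ρ : VectorMeasure ℝ V) (hρ : ρ.variation univ ≤ K) : Integrable φ ρ.variation := by
      have : IsFiniteMeasure ρ.variation := ⟨hρ.trans_lt ENNReal.coe_lt_top⟩
      refine hφ.integrable_of_hasCompactSupport
        ((isCompact_Icc (a := 0) (b := S)).of_isClosed_subset (isClosed_tsupport φ) ?_ :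
          HasCompactSupport φ)
      refine closure_minimal (fun x hx => ?_) isClosed_Icc
      by_contra h
      exact hx (hφ0 x fun h' => h (Ioo_subset_Icc_self h'))
    rw [Metric.tendsto_atTop]
    intro ε hε
    set η : ℝ := ε / (3 * (K + 1)) with hη
    have hηpos : 0 < η := by positivity
    have hηK : η * K < ε / 3 := by
      have : η * (K + 1) = ε / 3 := by rw [hη]; field_simp
      nlinarith
    obtain ⟨ψ, hψ, hψφ⟩ := exists_isTestFunction_abs_sub_le hφ hφ0 hηpos
    have hψi (ρ : VectorMeasure ℝ V) (hρ : ρ.variation univ ≤ K) : Integrable ψ ρ.variation := by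
      have : IsFiniteMeasure ρ.variation := ⟨hρ.trans_lt ENNReal.coe_lt_top⟩
      exact hψ.smooth.continuous.integrable_of_hasCompactSupport hψ.compact
    obtain ⟨N, hN⟩ := Metric.tendsto_atTop.1 (hconv ψ hψ) (ε / 3) (by positivity)
    refine ⟨N, fun n hn => ?_⟩
    have h1 := norm_vmIntegral_sub_le (hμK n) (hφi _ (hμK n)) (hψi _ (hμK n)) hψφ
    have h2 := norm_vmIntegral_sub_le hνK (hφi _ hνK) (hψi _ hνK) hψφ
    have h3 := hN n hn
    rw [← dist_eq_norm] at h1 h2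
    rw [dist_comm] at h2
    have := dist_triangle4 (vmIntegral (μ n) φ) (vmIntegral (μ n) ψ) (vmIntegral ν ψ)
      (vmIntegral ν φ)
    linarith

/-! ### Lipschitz functions, their derivatives, and `W^{1,∞}` -/

section Lipschitz

variable {V : Type*} [NormedAddCommGroup V] [InnerProductSpace ℝ V] [FiniteDimensional ℝ V]

lemma LipschitzWith.integrableOn_deriv {f : ℝ → V} {L : ℝ≥0} (hf : LipschitzWith L f) {s : Set ℝ}
    (hs : volume s ≠ ∞) : IntegrableOn (deriv f) s :=
  IntegrableOn.of_bound hs.lt_top (aestronglyMeasurable_deriv f _) L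
    (.of_forall fun _ => norm_deriv_le_of_lipschitz hf)

lemma LipschitzWith.intervalIntegrable_deriv {f : ℝ → V} {L : ℝ≥0} (hf : LipschitzWith L f)
    (a b : ℝ) : IntervalIntegrable (deriv f) volume a b :=
  intervalIntegrable_iff.2 (hf.integrableOn_deriv (by simp))

/-- Integration by parts for Lipschitz functions. -/
lemma LipschitzWith.integral_deriv_smul_add_smul_deriv {f : ℝ → V} {φ : ℝ → ℝ} {L M : ℝ≥0}
    (hf : LipschitzWith L f) (hφ : LipschitzWith M φ) (a b : ℝ) :
    ∫ s in a..b, (deriv φ s • f s + φ s • deriv f s) = φ b • f b - φ a • f a := by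
  have hint : IntervalIntegrable (fun s => deriv φ s • f s + φ s • deriv f s) volume a b :=
    ((hφ.intervalIntegrable_deriv a b).smul_continuousOn hf.continuous.continuousOn).add
      ((hf.intervalIntegrable_deriv a b).continuousOn_smul hφ.continuous.continuousOn)
  refine ext_inner_left ℝ fun v => ?_
  have hv : LipschitzWith (‖innerSL ℝ v‖₊ * L) (fun s => ⟪v, f s⟫_ℝ) :=
    (innerSL ℝ v).lipschitz.comp hf
  have h1 := AbsolutelyContinuousOnInterval.integral_deriv_mul_eq_sub
    (hφ.lipschitzOnWith (s := uIcc a b)).absolutelyContinuousOnInterval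
    (hv.lipschitzOnWith (s := uIcc a b)).absolutelyContinuousOnInterval
  have h2 := (innerSL ℝ v).intervalIntegral_comp_comm hint
  simp only [innerSL_apply_apply] at h2
  rw [← h2, inner_sub_right, inner_smul_right, inner_smul_right, ← h1]
  refine intervalIntegral.integral_congr_ae ?_
  filter_upwards [hf.ae_differentiableAt_real] with s hs _
  have : deriv (fun s => ⟪v, f s⟫_ℝ) s = ⟪v, deriv f s⟫_ℝ :=
    ((innerSL ℝ v).hasFDerivAt.comp_hasDerivAt s hs.hasDerivAt).deriv
  rw [this, inner_add_right, inner_smul_right, inner_smul_right]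

lemma LipschitzWith.integral_deriv_eq_sub {f : ℝ → V} {L : ℝ≥0} (hf : LipschitzWith L f)
    (a b : ℝ) : ∫ s in a..b, deriv f s = f b - f a := by
  simpa using hf.integral_deriv_smul_add_smul_deriv (LipschitzWith.const (1 : ℝ)) a b

lemma LipschitzWith.hasW1infDeriv {f : ℝ → V} {L : ℝ≥0} (hf : LipschitzWith L f) {S : ℝ}
    (hS : 0 ≤ S) : HasW1infDeriv S f (deriv f) := by
  refine ⟨?_, ?_, fun φ hφ => ?_⟩
  · refine MemLp.of_bound hf.continuous.aestronglyMeasurable (‖f 0‖ + L * S) ?_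
    refine (ae_restrict_mem measurableSet_Ioo).mono fun s hs => ?_
    have h1 := hf.norm_sub_le s 0
    rw [sub_zero, Real.norm_eq_abs, abs_of_pos hs.1] at h1
    have h2 : (L : ℝ) * s ≤ L * S := by have := hs.2; gcongr
    have := norm_le_norm_add_norm_sub' (f s) (f 0)
    linarith
  · exact MemLp.of_bound (aestronglyMeasurable_deriv f _) L
      (.of_forall fun _ => norm_deriv_le_of_lipschitz hf)
  · obtain ⟨M, hM⟩ := hφ.exists_lipschitzWith
    have h1 := hf.integral_deriv_smul_add_smul_deriv hM 0 S
    rw [hφ.eq_zero_of_notMem (by simp), hφ.eq_zero_of_notMem (by simp), zero_smul, zero_smul,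
      sub_zero, intervalIntegral.integral_add
        ((hM.intervalIntegrable_deriv 0 S).smul_continuousOn hf.continuous.continuousOn)
        ((hf.intervalIntegrable_deriv 0 S).continuousOn_smul hM.continuous.continuousOn),
      intervalIntegral.integral_of_le hS, intervalIntegral.integral_of_le hS,
      integral_Ioc_eq_integral_Ioo, integral_Ioc_eq_integral_Ioo] at h1
    exact eq_neg_of_add_eq_zero_left h1

lemma HasW1infDeriv.congr {W : Type*} [NormedAddCommGroup W] [NormedSpace ℝ W] {S : ℝ}
    {f g f' : ℝ → W} (h : HasW1infDeriv S f f') (hfg : EqOn g f (Ioo 0 S)) :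
    HasW1infDeriv S g f' := by
  have hae : f =ᵐ[lebesgueOn S] g :=
    (ae_restrict_mem measurableSet_Ioo).mono fun s hs => (hfg hs).symm
  refine ⟨(memLp_congr_ae hae).1 h.memLp, h.memLp_deriv, fun φ hφ => ?_⟩
  rw [← h.weak_deriv φ hφ]
  refine integral_congr_ae ?_
  filter_upwards [hae] with s hs
  rw [hs]

/-- A smooth function of mean zero with compact support in `(0, S)` has a primitive of the same
kind. -/
lemma exists_isTestFunction_deriv_eq {S : ℝ} {ψ : ℝ → ℝ} (hψ : IsTestFunction S ψ)
    (h0 : ∫ s in (0 : ℝ)..S, ψ s = 0) : ∃ φ, IsTestFunction S φ ∧ deriv φ = ψ := by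
  have hc : Continuous ψ := hψ.smooth.continuous
  set φ : ℝ → ℝ := fun x => ∫ s in (0 : ℝ)..x, ψ s with hφ
  have hd : ∀ x, HasDerivAt φ (ψ x) x := fun x => hc.integral_hasStrictDerivAt 0 x |>.hasDerivAt
  have hderiv : deriv φ = ψ := funext fun x => (hd x).deriv
  rcases (tsupport ψ).eq_empty_or_nonempty with hemp | hne
  · have hz : ψ = 0 := tsupport_eq_empty_iff.1 hemp
    refine ⟨0, ⟨contDiff_const, HasCompactSupport.zero, by simp⟩, ?_⟩
    rw [hz]; ext x; simp
  -- Let `[p, q]` be the convex hull of the support of `ψ`.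
  obtain ⟨p, hp, hpmin⟩ := hψ.compact.exists_isLeast hne
  obtain ⟨q, hq, hqmax⟩ := hψ.compact.exists_isGreatest hne
  have hout : ∀ x, x ∉ Icc p q → ψ x = 0 := fun x hx =>
    image_eq_zero_of_notMem_tsupport fun h => hx ⟨hpmin h, hqmax h⟩
  have hS0 : 0 < S := (hψ.supp hp).1.trans (hψ.supp hp).2
  have hzero : ∀ x, x ∉ Icc p q → φ x = 0 := by
    intro x hx
    rw [mem_Icc, not_and_or, not_le, not_le] at hx
    rcases hx with hx | hx
    · have : EqOn ψ 0 (uIcc 0 x) := fun y hy => hout y fun h => by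
        have := hy.2.trans (sup_le (hψ.supp hp).1.le hx.le)
        have hy2 : y ≤ max 0 x := hy.2
        have : max 0 x < p := max_lt (hψ.supp hp).1 hx
        linarith [h.1]
      simp only [hφ]
      rw [intervalIntegral.integral_congr this]; simp
    · have : EqOn ψ 0 (uIcc S x) := fun y hy => hout y fun h => by
        have hy2 : min S x ≤ y := hy.1
        have : q < min S x := lt_min (hψ.supp hq).2 hx
        linarith [h.2]
      simp only [hφ]
      rw [← intervalIntegral.integral_add_adjacent_intervals (hc.intervalIntegrable 0 S)
        (hc.intervalIntegrable S x), h0, intervalIntegral.integral_congr this]; simp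
  have hsub : tsupport φ ⊆ Icc p q := closure_minimal
    (fun x hx => by by_contra h; exact hx (hzero x h)) isClosed_Icc
  refine ⟨φ, ⟨?_, isCompact_Icc.of_isClosed_subset (isClosed_tsupport φ) hsub, ?_⟩, hderiv⟩
  · rw [contDiff_infty_iff_deriv, hderiv]
    exact ⟨fun x => (hd x).differentiableAt, hψ.smooth⟩
  · exact hsub.trans fun x hx =>
      ⟨(hψ.supp hp).1.trans_le hx.1, hx.2.trans_lt (hψ.supp hq).2⟩

/-- The lemma of du Bois-Reymond: a continuous function whose weak derivative vanishes is
constant. -/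
lemma eq_of_integral_deriv_smul_eq_zero {h : ℝ → V} {S : ℝ} (hS : 0 < S)
    (hc : ContinuousOn h (Icc 0 S))
    (h0 : ∀ φ, IsTestFunction S φ → ∫ s, deriv φ s • h s ∂(lebesgueOn S) = 0) :
    ∀ x ∈ Icc 0 S, h x = h 0 := by
  have hint : IntegrableOn h (Ioo 0 S) :=
    (hc.integrableOn_compact isCompact_Icc).mono_set Ioo_subset_Icc_self
  have hmul (ψ : ℝ → ℝ) (hψ : IsTestFunction S ψ) :
      IntegrableOn (fun s => ψ s • h s) (Ioo 0 S) :=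
    ((hψ.smooth.continuous.continuousOn.smul hc).integrableOn_compact isCompact_Icc).mono_set
      Ioo_subset_Icc_self
  have hfull (ψ : ℝ → ℝ) (hψ : IsTestFunction S ψ) : ∫ s in (0 : ℝ)..S, ψ s = ∫ s, ψ s := by
    refine intervalIntegral.integral_eq_integral_of_support_subset fun x hx => ?_
    exact Ioo_subset_Ioc_self (hψ.supp (subset_tsupport _ hx))
  let β : ContDiffBump (S / 2) := ⟨S / 8, S / 4, by positivity, by linarith⟩
  set η : ℝ → ℝ := β.normed volume with hη
  have hηt : IsTestFunction S η := by
    refine ⟨β.contDiff_normed, β.hasCompactSupport_normed, ?_⟩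
    rw [hη, β.tsupport_normed_eq, Real.closedBall_eq_Icc]
    intro x hx
    have h1 : S / 2 - S / 4 ≤ x := hx.1
    have h2 : x ≤ S / 2 + S / 4 := hx.2
    constructor <;> linarith
  have hηint : ∫ s, η s = 1 := β.integral_normed
  set c : V := ∫ s in Ioo 0 S, η s • h s with hcdef
  have hae : ∀ᵐ x, x ∈ Ioo 0 S → h x - c = 0 := by
    refine isOpen_Ioo.ae_eq_zero_of_integral_contDiff_smul_eq_zero
      (hint.sub (integrable_const c)).locallyIntegrableOn fun g hg hgc hgs => ?_
    have hgt : IsTestFunction S g := ⟨hg, hgc, hgs⟩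
    set I : ℝ := ∫ s, g s with hI
    -- Subtracting a multiple of `η` makes the mean of `g` vanish.
    have hψ : IsTestFunction S (fun s => g s - I * η s) := by
      refine ⟨hg.sub (contDiff_const.mul hηt.smooth), hgc.sub hηt.compact.mul_left, ?_⟩
      exact (tsupport_sub g _).trans (union_subset hgs
        ((tsupport_mul_subset_right (f := fun _ => I) (g := η)).trans hηt.supp))
    obtain ⟨φ, hφ, hφψ⟩ := exists_isTestFunction_deriv_eq hψ (by
      rw [hfull _ hψ, integral_sub (hg.continuous.integrable_of_hasCompactSupport hgc)
        ((hηt.smooth.continuous.integrable_of_hasCompactSupport hηt.compact).const_mul I),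
        integral_const_mul, hηint, mul_one, sub_self])
    have h1 := h0 φ hφ
    rw [hφψ, lebesgueOn] at h1
    have h2 : ∫ s in Ioo 0 S, g s • h s = I • c := by
      have hηI : IntegrableOn (fun s => I • η s • h s) (Ioo 0 S) := (hmul η hηt).smul I
      rw [hcdef, ← integral_smul, ← sub_eq_zero, ← integral_sub (hmul g hgt) hηI, ← h1]
      refine integral_congr_ae (.of_forall fun s => ?_)
      simp only [sub_smul, mul_smul]
    have h3 : ∫ s, g s • (h s - c) = ∫ s in Ioo 0 S, g s • (h s - c) :=
      (setIntegral_eq_integral_of_forall_compl_eq_zero fun s hs => by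
        rw [hgt.eq_zero_of_notMem hs, zero_smul]).symm
    have h4 : ∫ s in Ioo 0 S, g s = I :=
      setIntegral_eq_integral_of_forall_compl_eq_zero fun s hs => hgt.eq_zero_of_notMem hs
    rw [h3]
    simp_rw [smul_sub]
    rw [integral_sub (hmul g hgt)
      ((hg.continuous.integrable_of_hasCompactSupport hgc).integrableOn.smul_const c),
      integral_smul_const, h4, h2, sub_self]
  have heq : EqOn h (fun _ => c) (Ioo 0 S) := by
    refine Measure.eqOn_open_of_ae_eq (μ := volume) ?_ isOpen_Ioo (hc.mono Ioo_subset_Icc_self)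
      continuousOn_const
    refine (ae_restrict_iff' measurableSet_Ioo).2 (hae.mono fun x hx hx' => ?_)
    exact sub_eq_zero.1 (hx hx')
  have hIcc : EqOn h (fun _ => c) (Icc 0 S) :=
    heq.of_subset_closure hc continuousOn_const Ioo_subset_Icc_self
      (by rw [closure_Ioo hS.ne])
  intro x hx
  rw [hIcc hx, hIcc (left_mem_Icc.2 hS.le)]

/-- A continuous function in `W^{1,∞}(0, S)` is the primitive of its weak derivative. -/
lemma HasW1infDeriv.sub_eq_integral {f f' : ℝ → V} {S : ℝ} (h : HasW1infDeriv S f f')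
    (hS : 0 < S) (hc : ContinuousOn f (Icc 0 S)) {a b : ℝ} (ha : a ∈ Icc 0 S) (hb : b ∈ Icc 0 S) :
    f b - f a = ∫ s in a..b, f' s := by
  set g : ℝ → V := (Ioo 0 S).indicator f' with hg
  set C : ℝ≥0 := (eLpNorm f' ∞ (lebesgueOn S)).toNNReal with hC
  have hgm : AEStronglyMeasurable g := 
    (aestronglyMeasurable_indicator_iff measurableSet_Ioo).2 h.memLp_deriv.aestronglyMeasurable
  have hgb : ∀ᵐ s, ‖g s‖ ≤ C := by
    have h1 : ∀ᵐ s ∂(lebesgueOn S), ‖f' s‖ ≤ C := by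
      filter_upwards [enorm_ae_le_eLpNormEssSup f' (lebesgueOn S)] with s hs
      rw [← eLpNorm_exponent_top] at hs
      have := ENNReal.toReal_mono h.memLp_deriv.eLpNorm_ne_top hs
      rwa [toReal_enorm] at this
    filter_upwards [(ae_restrict_iff' measurableSet_Ioo).1 h1] with s hs
    by_cases hs' : s ∈ Ioo 0 S
    · simpa [hg, hs'] using hs hs'
    · simp [hg, hs']
  have hgi (a b : ℝ) : IntervalIntegrable g volume a b := by
    rw [intervalIntegrable_iff]
    exact IntegrableOn.of_bound (by simp) hgm.restrict C (ae_restrict_of_ae hgb)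
  set u : ℝ → V := fun x => ∫ s in (0 : ℝ)..x, g s with hu
  have huL : LipschitzWith C u := LipschitzWith.of_dist_le_mul fun x y => by
    rw [dist_eq_norm, dist_comm, Real.dist_eq, hu]
    simp only []
    rw [intervalIntegral.integral_interval_sub_left (hgi _ _) (hgi _ _), abs_sub_comm]
    exact intervalIntegral.norm_integral_le_of_norm_le_const_ae (hgb.mono fun s hs _ => hs)
  have hgloc : LocallyIntegrable g := by
    refine MeasureTheory.LocallyIntegrable.mono (g := g) (f := fun _ => (C : ℝ))
      (locallyIntegrable_const _) hgm ?_
    filter_upwards [hgb] with s hs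
    simpa using hs
  have hud : deriv u =ᵐ[volume] g := by
    filter_upwards [_root_.LocallyIntegrable.ae_hasDerivAt_integral hgloc] with x hx
    exact (hx 0).deriv
  have hu' := huL.hasW1infDeriv hS.le
  have hconst := eq_of_integral_deriv_smul_eq_zero hS (h := fun x => f x - u x)
    (hc.sub huL.continuous.continuousOn) (fun φ hφ => by
      obtain ⟨M, hM⟩ := hφ.exists_lipschitzWith
      have hb1 : ∀ᵐ s ∂(lebesgueOn S), ‖deriv φ s‖ ≤ M :=
        .of_forall fun s => norm_deriv_le_of_lipschitz hM
      have h1 : Integrable (fun s => deriv φ s • f s) (lebesgueOn S) :=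
        (h.memLp.integrable le_top).bdd_smul M hφ.continuous_deriv.aestronglyMeasurable hb1
      have h2 : Integrable (fun s => deriv φ s • u s) (lebesgueOn S) :=
        (hu'.memLp.integrable le_top).bdd_smul M hφ.continuous_deriv.aestronglyMeasurable hb1
      simp_rw [smul_sub]
      rw [integral_sub h1 h2, h.weak_deriv φ hφ, hu'.weak_deriv φ hφ, sub_eq_zero, neg_inj]
      refine integral_congr_ae ?_
      filter_upwards [ae_restrict_of_ae hud, ae_restrict_mem measurableSet_Ioo] with s hs hs'
      rw [hs, hg, indicator_of_mem hs'])
  have hval : f b - f a = u b - u a := by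
    have h1 := hconst a ha
    have h2 := hconst b hb
    rw [← h1] at h2
    rw [sub_eq_sub_iff_add_eq_add] at h2 ⊢
    rw [h2]; abel
  rw [hval, hu, intervalIntegral.integral_interval_sub_left (hgi _ _) (hgi _ _)]
  refine intervalIntegral.integral_congr_ae ?_
  have h1 : ∀ᵐ s : ℝ, s ≠ S := by simp [ae_iff, measure_singleton]
  filter_upwards [h1] with s hs hs'
  have hmem : s ∈ Ioo 0 S := by
    rw [mem_uIoc] at hs'
    rcases hs' with hs' | hs'
    · exact ⟨ha.1.trans_lt hs'.1, lt_of_le_of_ne (hs'.2.trans hb.2) hs⟩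
    · exact ⟨hb.1.trans_lt hs'.1, lt_of_le_of_ne (hs'.2.trans ha.2) hs⟩
  rw [hg, indicator_of_mem hmem]

end Lipschitz

section WeakStar

variable {V : Type*} [NormedAddCommGroup V] [InnerProductSpace ℝ V] [FiniteDimensional ℝ V]

/-! ### Weak* convergence of the derivatives of Lipschitz functions -/

omit [InnerProductSpace ℝ V] [FiniteDimensional ℝ V] in
lemma lipschitzWith_of_tendsto {f : ℕ → ℝ → V} {g : ℝ → V} {L : ℝ≥0}
    (hf : ∀ n, LipschitzWith L (f n)) (h : ∀ x, Tendsto (fun n => f n x) atTop (𝓝 (g x))) :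
    LipschitzWith L g :=
  LipschitzWith.of_dist_le_mul fun x y =>
    le_of_tendsto' ((h x).dist (h y)) fun n => (hf n).dist_le_mul x y

/-- Uniformly Lipschitz functions converging pointwise: the derivatives converge weakly* in
`L^∞(ℝ)`, tested with scalar functions. By density it suffices to test with smooth functions, and
there one integrates by parts. -/
lemma tendsto_integral_smul_deriv {f : ℕ → ℝ → V} {g : ℝ → V} {L : ℝ≥0} {B : ℝ}
    (hf : ∀ n, LipschitzWith L (f n)) (hB : ∀ n x, ‖f n x‖ ≤ B)
    (h : ∀ x, Tendsto (fun n => f n x) atTop (𝓝 (g x))) {φ : ℝ → ℝ} (hφ : Integrable φ) :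
    Tendsto (fun n => ∫ s, φ s • deriv (f n) s) atTop (𝓝 (∫ s, φ s • deriv g s)) := by
  have hg : LipschitzWith L g := lipschitzWith_of_tendsto hf h
  have hmul {u : ℝ → V} (hu : LipschitzWith L u) {φ : ℝ → ℝ} (hφ : Integrable φ) :
      Integrable (fun s => φ s • deriv u s) :=
    hφ.smul_bdd L (aestronglyMeasurable_deriv u _)
      (.of_forall fun s => norm_deriv_le_of_lipschitz hu)
  have hparts {u : ℝ → V} (hu : LipschitzWith L u) {ψ : ℝ → ℝ} (hψ : ContDiff ℝ (⊤ : ℕ∞) ψ)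
      (hψc : HasCompactSupport ψ) : ∫ s, ψ s • deriv u s = - ∫ s, deriv ψ s • u s := by
    obtain ⟨M, hM⟩ := hψ.lipschitzWith_of_hasCompactSupport hψc (by simp)
    obtain ⟨R, hR⟩ := hψc.isBounded.subset_closedBall 0
    rw [Real.closedBall_eq_Icc] at hR
    have hsub : tsupport ψ ⊆ Ioc (0 - R - 1) (0 + R) := hR.trans fun x hx =>
      ⟨by linarith [hx.1], hx.2⟩
    have h0 : ψ (0 - R - 1) = 0 := image_eq_zero_of_notMem_tsupport fun h' => by
      have := (hR h').1; linarith
    have h1 := hu.integral_deriv_smul_add_smul_deriv hM (0 - R - 1) (0 + R + 1)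
    have h2 : ψ (0 + R + 1) = 0 := image_eq_zero_of_notMem_tsupport fun h' => by
      have := (hR h').2; linarith
    rw [h0, h2, zero_smul, zero_smul, sub_zero, intervalIntegral.integral_add
        ((hM.intervalIntegrable_deriv _ _).smul_continuousOn hu.continuous.continuousOn)
        ((hu.intervalIntegrable_deriv _ _).continuousOn_smul hM.continuous.continuousOn),
      intervalIntegral.integral_eq_integral_of_support_subset,
      intervalIntegral.integral_eq_integral_of_support_subset] at h1
    · exact eq_neg_of_add_eq_zero_right h1
    · refine (Function.support_smul_subset_left _ _).trans ((subset_tsupport ψ).trans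
        (hsub.trans ?_))
      exact Ioc_subset_Ioc_right (by linarith)
    · refine (Function.support_smul_subset_left _ _).trans
        ((support_deriv_subset).trans (hsub.trans ?_))
      exact Ioc_subset_Ioc_right (by linarith)
  have hsmooth {ψ : ℝ → ℝ} (hψ : ContDiff ℝ (⊤ : ℕ∞) ψ) (hψc : HasCompactSupport ψ) :
      Tendsto (fun n => ∫ s, ψ s • deriv (f n) s) atTop (𝓝 (∫ s, ψ s • deriv g s)) := by
    rw [hparts hg hψ hψc]
    simp_rw [hparts (hf _) hψ hψc]
    have hc : Continuous (deriv ψ) := hψ.continuous_deriv (by simp)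
    refine Tendsto.neg (tendsto_integral_of_dominated_convergence (fun s => ‖deriv ψ s‖ * B)
      (fun n => (hc.smul (hf n).continuous).aestronglyMeasurable)
      ((hc.integrable_of_hasCompactSupport hψc.deriv).norm.mul_const B)
      (fun n => .of_forall fun s => ?_) (.of_forall fun s => (h s).const_smul _))
    rw [norm_smul]
    exact mul_le_mul_of_nonneg_left (hB n s) (norm_nonneg _)
  rw [Metric.tendsto_atTop]
  intro ε hε
  set η : ℝ := ε / (3 * (L + 1)) with hη
  have hηpos : 0 < η := by positivity
  have hηL : L * η < ε / 3 := by
    have : η * (L + 1) = ε / 3 := by rw [hη]; field_simp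
    nlinarith
  obtain ⟨ψ, hψc, hψ, hφψ⟩ := MemLp.exist_eLpNorm_sub_le (p := 1) (by simp) le_rfl
    (memLp_one_iff_integrable.2 hφ) hηpos
  have hψi : Integrable ψ := hψ.continuous.integrable_of_hasCompactSupport hψc
  have happrox : ∫ s, ‖φ s - ψ s‖ ≤ η := by
    rw [show ∫ s, ‖φ s - ψ s‖ = ∫ s, ‖(φ - ψ) s‖ from rfl,
      integral_norm_eq_lintegral_enorm (hφ.sub hψi).aestronglyMeasurable]
    refine ENNReal.toReal_le_of_le_ofReal hηpos.le ?_
    rw [eLpNorm_one_eq_lintegral_enorm] at hφψ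
    exact hφψ
  have hclose {u : ℝ → V} (hu : LipschitzWith L u) :
      ‖(∫ s, φ s • deriv u s) - ∫ s, ψ s • deriv u s‖ ≤ L * η := by
    rw [← integral_sub (hmul hu hφ) (hmul hu hψi)]
    calc _ ≤ ∫ s, L * ‖φ s - ψ s‖ := by
          refine norm_integral_le_of_norm_le ((hφ.sub hψi).norm.const_mul _)
            (.of_forall fun s => ?_)
          rw [← sub_smul, norm_smul, mul_comm]
          exact mul_le_mul_of_nonneg_right (norm_deriv_le_of_lipschitz hu) (norm_nonneg _)
      _ = L * ∫ s, ‖φ s - ψ s‖ := integral_const_mul _ _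
      _ ≤ L * η := by gcongr
  obtain ⟨N, hN⟩ := Metric.tendsto_atTop.1 (hsmooth hψ hψc) (ε / 3) (by positivity)
  refine ⟨N, fun n hn => ?_⟩
  have h1 := hclose (hf n)
  have h2 := hclose hg
  have h3 := hN n hn
  rw [← dist_eq_norm] at h1 h2
  rw [dist_comm] at h2
  have := dist_triangle4 (∫ s, φ s • deriv (f n) s) (∫ s, ψ s • deriv (f n) s)
    (∫ s, ψ s • deriv g s) (∫ s, φ s • deriv g s)
  linarith

lemma tendsto_integral_inner_deriv {f : ℕ → ℝ → V} {g : ℝ → V} {L : ℝ≥0} {B : ℝ}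
    (hf : ∀ n, LipschitzWith L (f n)) (hB : ∀ n x, ‖f n x‖ ≤ B)
    (h : ∀ x, Tendsto (fun n => f n x) atTop (𝓝 (g x))) {w : ℝ → V} (hw : Integrable w) :
    Tendsto (fun n => ∫ s, ⟪deriv (f n) s, w s⟫_ℝ) atTop (𝓝 (∫ s, ⟪deriv g s, w s⟫_ℝ)) := by
  let b := stdOrthonormalBasis ℝ V
  have hwi (i) : Integrable fun s => ⟪b i, w s⟫_ℝ := hw.const_inner (b i)
  have hexp {u : ℝ → V} (hu : LipschitzWith L u) :
      ∫ s, ⟪deriv u s, w s⟫_ℝ = ∑ i, ⟪b i, ∫ s, ⟪b i, w s⟫_ℝ • deriv u s⟫_ℝ := by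
    have hint (i) : Integrable (fun s => ⟪b i, w s⟫_ℝ • deriv u s) :=
      (hwi i).smul_bdd L (aestronglyMeasurable_deriv u _)
        (.of_forall fun s => norm_deriv_le_of_lipschitz hu)
    have h1 (i) : ⟪b i, ∫ s, ⟪b i, w s⟫_ℝ • deriv u s⟫_ℝ =
        ∫ s, ⟪b i, ⟪b i, w s⟫_ℝ • deriv u s⟫_ℝ := (integral_inner (hint i) (b i)).symm
    simp_rw [h1]
    rw [← integral_finsetSum _ fun i _ => (hint i).const_inner (b i)]
    refine integral_congr_ae (.of_forall fun s => ?_)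
    dsimp only
    rw [← b.sum_inner_mul_inner]
    refine Finset.sum_congr rfl fun i _ => ?_
    rw [inner_smul_right, real_inner_comm, mul_comm]
  rw [hexp (lipschitzWith_of_tendsto hf h)]
  simp_rw [hexp (hf _)]
  exact tendsto_finsetSum _ fun i _ =>
    tendsto_const_nhds.inner (tendsto_integral_smul_deriv hf hB h (hwi i))

/-- Pointwise convergence of uniformly bounded, uniformly Lipschitz functions implies weak*
convergence in `W^{1,∞}`. -/
lemma w1infWeakStar_of_tendsto {f : ℕ → ℝ → V} {g : ℝ → V} {L : ℝ≥0} {B : ℝ}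
    (hf : ∀ n, LipschitzWith L (f n)) (hB : ∀ n x, ‖f n x‖ ≤ B)
    (h : ∀ x, Tendsto (fun n => f n x) atTop (𝓝 (g x))) {S : ℝ} (hS : 0 ≤ S) :
    W1infWeakStar S f g := by
  have hg : LipschitzWith L g := lipschitzWith_of_tendsto hf h
  refine ⟨fun n => deriv (f n), deriv g, fun n => (hf n).hasW1infDeriv hS, hg.hasW1infDeriv hS,
    ⟨fun n => ((hf n).hasW1infDeriv hS).memLp, (hg.hasW1infDeriv hS).memLp, fun w hw => ?_⟩,
    ⟨fun n => ((hf n).hasW1infDeriv hS).memLp_deriv, (hg.hasW1infDeriv hS).memLp_deriv,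
      fun w hw => ?_⟩⟩
  · refine tendsto_integral_of_dominated_convergence (fun s => B * ‖w s‖)
      (fun n => (hf n).continuous.aestronglyMeasurable.inner hw.aestronglyMeasurable)
      (hw.norm.const_mul B) (fun n => .of_forall fun s => ?_)
      (.of_forall fun s => (h s).inner tendsto_const_nhds)
    exact (norm_inner_le_norm _ _).trans (mul_le_mul_of_nonneg_right (hB n s) (norm_nonneg _))
  · have h1 := tendsto_integral_inner_deriv hf hB h
      (w := (Ioo 0 S).indicator w) ((integrable_indicator_iff measurableSet_Ioo).2 hw)
    have h2 (u : ℝ → V) : ∫ s, ⟪u s, (Ioo 0 S).indicator w s⟫_ℝ =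
        ∫ s, ⟪u s, w s⟫_ℝ ∂(lebesgueOn S) := by
      rw [lebesgueOn, ← integral_indicator measurableSet_Ioo]
      congr 1
      ext s
      by_cases hs : s ∈ Ioo 0 S <;> simp [hs]
    simpa only [h2] using h1

/-- The pairing of a boundedly and pointwise convergent sequence with the weakly* convergent
derivatives of Lipschitz functions. -/
lemma tendsto_intervalIntegral_inner_deriv {f : ℕ → ℝ → V} {g : ℝ → V} {L : ℝ≥0} {B : ℝ}
    (hf : ∀ n, LipschitzWith L (f n)) (hB : ∀ n x, ‖f n x‖ ≤ B)
    (h : ∀ x, Tendsto (fun n => f n x) atTop (𝓝 (g x)))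
    {w : ℕ → ℝ → V} {v : ℝ → V} {D : ℝ} (hwm : ∀ n, StronglyMeasurable (w n))
    (hwD : ∀ n x, ‖w n x‖ ≤ D) (hw : ∀ x, Tendsto (fun n => w n x) atTop (𝓝 (v x)))
    {a b : ℝ} (hab : a ≤ b) :
    Tendsto (fun n => ∫ s in a..b, ⟪w n s, deriv (f n) s⟫_ℝ) atTop
      (𝓝 (∫ s in a..b, ⟪v s, deriv g s⟫_ℝ)) := by
  have hvm : StronglyMeasurable v :=
    stronglyMeasurable_of_tendsto atTop hwm (tendsto_pi_nhds.2 hw)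
  have hvD : ∀ x, ‖v x‖ ≤ D := fun x => le_of_tendsto' (hw x).norm fun n => hwD n x
  have hint (n : ℕ) : IntegrableOn (w n) (Ioc a b) :=
    IntegrableOn.of_bound (by simp) (hwm n).aestronglyMeasurable D (.of_forall (hwD n))
  have hvint : IntegrableOn v (Ioc a b) :=
    IntegrableOn.of_bound (by simp) hvm.aestronglyMeasurable D (.of_forall hvD)
  have hin {p : ℝ → V} (hpm : StronglyMeasurable p) (hp : ∀ x, ‖p x‖ ≤ D) (n : ℕ) :
      IntegrableOn (fun s => ⟪p s, deriv (f n) s⟫_ℝ) (Ioc a b) := by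
    refine IntegrableOn.of_bound (by simp)
      (hpm.aestronglyMeasurable.inner (aestronglyMeasurable_deriv _ _)) (D * L)
      (.of_forall fun s => (norm_inner_le_norm _ _).trans ?_)
    exact mul_le_mul (hp s) (norm_deriv_le_of_lipschitz (hf n)) (norm_nonneg _)
      ((norm_nonneg _).trans (hp s))
  have hfix : Tendsto (fun n => ∫ s in a..b, ⟪v s, deriv (f n) s⟫_ℝ) atTop
      (𝓝 (∫ s in a..b, ⟪v s, deriv g s⟫_ℝ)) := by
    have h1 := tendsto_integral_inner_deriv hf hB h
      (w := (Ioc a b).indicator v) ((integrable_indicator_iff measurableSet_Ioc).2 hvint)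
    have h2 (u : ℝ → V) : ∫ s, ⟪u s, (Ioc a b).indicator v s⟫_ℝ =
        ∫ s in a..b, ⟪v s, u s⟫_ℝ := by
      rw [intervalIntegral.integral_of_le hab, ← integral_indicator measurableSet_Ioc]
      congr 1
      ext s
      by_cases hs : s ∈ Ioc a b <;> simp [hs, real_inner_comm]
    simpa only [h2] using h1
  have hsmall : Tendsto (fun n => (∫ s in a..b, ⟪w n s, deriv (f n) s⟫_ℝ) -
      ∫ s in a..b, ⟪v s, deriv (f n) s⟫_ℝ) atTop (𝓝 0) := by
    have h1 : Tendsto (fun n => ∫ s in Ioc a b, L * ‖w n s - v s‖) atTop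
        (𝓝 (∫ s in Ioc a b, (0 : ℝ))) := by
      refine tendsto_integral_of_dominated_convergence (fun _ => L * (D + D))
        (fun n => ((hwm n).sub hvm).norm.aestronglyMeasurable.const_mul _)
        (integrable_const _) (fun n => .of_forall fun s => ?_) (.of_forall fun s => ?_)
      · rw [norm_mul, norm_norm, NNReal.norm_eq]
        exact mul_le_mul_of_nonneg_left
          ((norm_sub_le _ _).trans (add_le_add (hwD n s) (hvD s))) L.2
      · have := ((hw s).sub_const (v s)).norm.const_mul (L : ℝ)
        simpa using this
    rw [integral_zero] at h1
    refine squeeze_zero_norm (fun n => ?_) h1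
    rw [intervalIntegral.integral_of_le hab, intervalIntegral.integral_of_le hab,
      ← integral_sub (hin (hwm n) (hwD n) n) (hin hvm hvD n)]
    refine norm_integral_le_of_norm_le (((hint n).sub hvint).norm.const_mul _)
      (.of_forall fun s => ?_)
    rw [← inner_sub_left, mul_comm]
    exact (norm_inner_le_norm _ _).trans
      (mul_le_mul_of_nonneg_left (norm_deriv_le_of_lipschitz (hf n)) (norm_nonneg _))
  simpa using hsmall.add hfix

omit [InnerProductSpace ℝ V] [FiniteDimensional ℝ V] in
/-- A function with nonnegative integrals over all compact subintervals of `(0, S)` is nonnegative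
almost everywhere in `(0, S)`. -/
lemma ae_nonneg_of_intervalIntegral_nonneg {g : ℝ → ℝ} {S : ℝ} (hg : LocallyIntegrable g)
    (h : ∀ a b, 0 < a → a < b → b < S → 0 ≤ ∫ s in a..b, g s) :
    ∀ᵐ s, s ∈ Ioo 0 S → 0 ≤ g s := by
  have hi (a b : ℝ) : IntervalIntegrable g volume a b :=
    (hg.integrableOn_isCompact isCompact_uIcc).intervalIntegrable
  filter_upwards [_root_.LocallyIntegrable.ae_hasDerivAt_integral hg] with s hs hsS
  have h1 := (hs s).hasDerivWithinAt (s := Ioi s)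
  rw [hasDerivWithinAt_iff_tendsto_slope' (by simp)] at h1
  refine ge_of_tendsto h1 ?_
  filter_upwards [Ioo_mem_nhdsGT hsS.2] with x hx
  rw [slope_def_field, intervalIntegral.integral_same, sub_zero]
  exact div_nonneg (h s x hsS.1 hx.1 hx.2) (sub_nonneg.2 hx.1.le)

/-- Integration by parts bounds the work of the load `f` of bounded variation along the curve `z`
without reference to the length of the curve. -/
lemma abs_integral_inner_deriv_sub_le {f z : ℝ → V} {K L : ℝ≥0} {B M a b : ℝ}
    (hf : eVariationOn f univ ≤ K) (hB : ∀ x, ‖f x‖ ≤ B) (hz : LipschitzWith L z) (hab : a ≤ b)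
    (hM : ∀ x ∈ Icc a b, ‖z x‖ ≤ M) :
    |(∫ s in a..b, ⟪f s, deriv z s⟫_ℝ) - (⟪f b, z b⟫_ℝ - ⟪f a, z a⟫_ℝ)| ≤ M * K := by
  have hfm : StronglyMeasurable f :=
    BoundedVariationOn.stronglyMeasurable (hf.trans_lt ENNReal.coe_lt_top).ne
  have hint (x y : ℝ) : IntervalIntegrable (fun s => ⟪f s, deriv z s⟫_ℝ) volume x y := by
    rw [intervalIntegrable_iff]
    refine IntegrableOn.of_bound (by simp)
      (hfm.aestronglyMeasurable.inner (aestronglyMeasurable_deriv _ _)) (B * L)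
      (.of_forall fun s => (norm_inner_le_norm _ _).trans ?_)
    exact mul_le_mul (hB s) (norm_deriv_le_of_lipschitz hz) (norm_nonneg _)
      ((norm_nonneg _).trans (hB s))
  obtain ⟨W, hW, hWK, hWd⟩ := exists_monotone_dist_le hf
  set H : ℝ → ℝ := fun x => (∫ s in a..x, ⟪f s, deriv z s⟫_ℝ) - ⟪f x, z x⟫_ℝ with hH
  have key : ‖H b - H a‖ ≤ M * (W b - W a) := by
    refine norm_sub_le_of_norm_increment_le (C := L) hab fun x hx y hy hxy => ?_
    have h1 : ∫ s in x..y, ⟪f s - f x, deriv z s⟫_ℝ =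
        (∫ s in x..y, ⟪f s, deriv z s⟫_ℝ) - ⟪f x, z y - z x⟫_ℝ := by
      have h2 := (innerSL ℝ (f x)).intervalIntegral_comp_comm (hz.intervalIntegrable_deriv x y)
      simp only [innerSL_apply_apply, hz.integral_deriv_eq_sub] at h2
      simp_rw [inner_sub_left]
      rw [← h2, intervalIntegral.integral_sub (hint x y)]
      exact ⟨(hz.intervalIntegrable_deriv x y).1.const_inner (f x),
        (hz.intervalIntegrable_deriv x y).2.const_inner (f x)⟩
    have hinc : H y - H x = (∫ s in x..y, ⟪f s - f x, deriv z s⟫_ℝ) - ⟪f y - f x, z y⟫_ℝ := by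
      rw [h1]
      simp only [hH]
      rw [← intervalIntegral.integral_add_adjacent_intervals (hint a x) (hint x y),
        inner_sub_left, inner_sub_right]
      ring
    have h3 : ‖∫ s in x..y, ⟪f s - f x, deriv z s⟫_ℝ‖ ≤ (W y - W x) * L * |y - x| := by
      refine intervalIntegral.norm_integral_le_of_norm_le_const fun s hs => ?_
      rw [uIoc_of_le hxy] at hs
      refine (norm_inner_le_norm _ _).trans (mul_le_mul ?_ (norm_deriv_le_of_lipschitz hz)
        (norm_nonneg _) (sub_nonneg.2 (hW hxy)))
      rw [← dist_eq_norm, dist_comm]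
      exact (hWd x s hs.1.le).trans (sub_le_sub_right (hW hs.2) _)
    have h4 : ‖⟪f y - f x, z y⟫_ℝ‖ ≤ (W y - W x) * M := by
      refine (norm_inner_le_norm _ _).trans (mul_le_mul ?_ (hM y hy) (norm_nonneg _)
        (sub_nonneg.2 (hW hxy)))
      rw [← dist_eq_norm, dist_comm]
      exact hWd x y hxy
    rw [abs_of_nonneg (sub_nonneg.2 hxy)] at h3
    rw [hinc]
    refine (norm_sub_le _ _).trans ((add_le_add h3 h4).trans_eq ?_)
    ring
  have hM0 : 0 ≤ M := (norm_nonneg _).trans (hM a (left_mem_Icc.2 hab))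
  have h5 : H b - H a = (∫ s in a..b, ⟪f s, deriv z s⟫_ℝ) - (⟪f b, z b⟫_ℝ - ⟪f a, z a⟫_ℝ) := by
    simp only [hH, intervalIntegral.integral_same]; ring
  rw [← h5, ← Real.norm_eq_abs]
  refine key.trans (mul_le_mul_of_nonneg_left ?_ hM0)
  linarith [(hWK a).1, (hWK b).2]

end WeakStar

/-! ### The dissipation and the energy -/

namespace RISystem.StandingAssumptions

variable {d : ℕ} {P : RISystem d}

local notation "𝕍" => EuclideanSpace ℝ (Fin d)

lemma R_nonneg (hP : P.StandingAssumptions) (v : 𝕍) : 0 ≤ P.R v := by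
  obtain ⟨c, C, hc, -, h⟩ := hP.R_bounds
  exact (by positivity : 0 ≤ c * ‖v‖).trans (h v).1

lemma R_zero (hP : P.StandingAssumptions) : P.R 0 = 0 := by
  obtain ⟨c, C, -, -, h⟩ := hP.R_bounds
  refine le_antisymm ?_ (hP.R_nonneg 0)
  simpa using (h 0).2

lemma mem_subdifferential_iff (hP : P.StandingAssumptions) {w : 𝕍} :
    w ∈ subdifferential P.R 0 ↔ ∀ v, ⟪w, v⟫_ℝ ≤ P.R v := by
  simp [subdifferential, hP.R_zero]

lemma zero_mem_subdifferential (hP : P.StandingAssumptions) :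
    (0 : 𝕍) ∈ subdifferential P.R 0 := by
  rw [hP.mem_subdifferential_iff]
  intro v
  simpa using hP.R_nonneg v

lemma isClosed_subdifferential (hP : P.StandingAssumptions) :
    IsClosed (subdifferential P.R 0) := by
  have : subdifferential P.R 0 = ⋂ v, {w : 𝕍 | ⟪w, v⟫_ℝ ≤ P.R v} := by
    ext w
    rw [hP.mem_subdifferential_iff, mem_iInter]
    rfl
  rw [this]
  exact isClosed_iInter fun v => isClosed_le (by fun_prop) continuous_const

lemma R_add_le (hP : P.StandingAssumptions) (v w : 𝕍) : P.R (v + w) ≤ P.R v + P.R w := by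
  have h1 := hP.R_convex.2 (mem_univ v) (mem_univ w) (by norm_num : (0 : ℝ) ≤ 1 / 2)
    (by norm_num : (0 : ℝ) ≤ 1 / 2) (by norm_num)
  rw [← smul_add, hP.R_hom _ _ (by norm_num)] at h1
  simp only [smul_eq_mul] at h1
  linarith

/-- `R` is the support function of `∂R(0)`, and the supremum is attained. -/
lemma exists_mem_subdifferential_inner_eq (hP : P.StandingAssumptions) (v : 𝕍) :
    ∃ w ∈ subdifferential P.R 0, ⟪w, v⟫_ℝ = P.R v := by
  rcases eq_or_ne v 0 with rfl | hv
  · exact ⟨0, hP.zero_mem_subdifferential, by simp [hP.R_zero]⟩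
  obtain ⟨g, hg, hgR⟩ := exists_extension_of_le_sublinear
    (LinearPMap.mkSpanSingleton (K := ℝ) v (P.R v) hv) P.R (fun c hc x => hP.R_hom c x hc)
    hP.R_add_le (by
      rintro ⟨x, hx⟩
      obtain ⟨a, rfl⟩ := Submodule.mem_span_singleton.1 hx
      refine (LinearPMap.mkSpanSingleton'_apply _ _ _ a hx).trans_le ?_
      simp only [RingHom.id_apply, smul_eq_mul]
      rcases lt_trichotomy a 0 with ha | rfl | ha
      · exact (mul_nonpos_of_nonpos_of_nonneg ha.le (hP.R_nonneg v)).trans (hP.R_nonneg _)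
      · simp [hP.R_zero]
      · rw [hP.R_hom a v ha])
  refine ⟨(InnerProductSpace.toDual ℝ 𝕍).symm (LinearMap.toContinuousLinearMap g), ?_, ?_⟩
  · rw [hP.mem_subdifferential_iff]
    intro u
    rw [InnerProductSpace.toDual_symm_apply]
    exact hgR u
  · rw [InnerProductSpace.toDual_symm_apply]
    have h1 := hg ⟨v, Submodule.mem_span_singleton_self v⟩
    rw [LinearPMap.mkSpanSingleton_apply] at h1
    exact h1

/-- The Fenchel–Young type estimate behind the energy-dissipation balance. -/
lemma inner_le_add_infDist (hP : P.StandingAssumptions) (ξ v : 𝕍) :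
    ⟪ξ, v⟫_ℝ ≤ P.R v + ‖v‖ * Metric.infDist ξ (subdifferential P.R 0) := by
  obtain ⟨w, hw, hd⟩ := hP.isClosed_subdifferential.exists_infDist_eq_dist
    ⟨0, hP.zero_mem_subdifferential⟩ ξ
  have h1 : ⟪ξ, v⟫_ℝ = ⟪w, v⟫_ℝ + ⟪ξ - w, v⟫_ℝ := by rw [inner_sub_left]; ring
  have h2 := real_inner_le_norm (ξ - w) v
  have h3 := hP.mem_subdifferential_iff.1 hw v
  rw [hd, dist_eq_norm, mul_comm]
  linarith

/-- For `δ ≥ 0` the function `v ↦ R(v) + δ ‖v‖` is a supremum of countably many linear functions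
`v ↦ ⟪w + δ e, v⟫`, with pairs `(w, e)` that do not depend on `δ`. -/
lemma exists_seq_forall_inner_le (hP : P.StandingAssumptions) :
    ∃ u : ℕ → 𝕍 × 𝕍, (∀ n, (u n).1 ∈ subdifferential P.R 0 ∧ ‖(u n).2‖ ≤ 1) ∧
      ∀ (v : 𝕍) (δ c : ℝ), (∀ n, ⟪(u n).1 + δ • (u n).2, v⟫_ℝ ≤ c) →
        P.R v + ‖v‖ * δ ≤ c := by
  set Q : Set (𝕍 × 𝕍) := {p | p.1 ∈ subdifferential P.R 0 ∧ ‖p.2‖ ≤ 1} with hQ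
  have : Nonempty Q := ⟨⟨(0, 0), hP.zero_mem_subdifferential, by simp⟩⟩
  refine ⟨fun n => (TopologicalSpace.denseSeq Q n : 𝕍 × 𝕍),
    fun n => (TopologicalSpace.denseSeq Q n).2, fun v δ c h => ?_⟩
  have hall : ∀ p : Q, ⟪(p : 𝕍 × 𝕍).1 + δ • (p : 𝕍 × 𝕍).2, v⟫_ℝ ≤ c := fun p =>
    (TopologicalSpace.denseRange_denseSeq Q).induction_on p
      (isClosed_le (by fun_prop) continuous_const) h
  obtain ⟨w, hw, hwv⟩ := hP.exists_mem_subdifferential_inner_eq v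
  have he : ‖‖v‖⁻¹ • v‖ ≤ 1 := by
    rw [norm_smul, norm_inv, norm_norm]
    exact inv_mul_le_one
  have h1 := hall ⟨(w, ‖v‖⁻¹ • v), hw, he⟩
  simp only [inner_add_left, inner_smul_left, hwv, real_inner_self_eq_norm_sq, conj_trivial] at h1
  rcases eq_or_ne v 0 with rfl | hv
  · simpa using h1
  · have h2 : ‖v‖ ≠ 0 := norm_ne_zero_iff.2 hv
    have h3 : δ * (‖v‖⁻¹ * ‖v‖ ^ 2) = ‖v‖ * δ := by field_simp
    rwa [h3] at h1

lemma contDiff_energy (hP : P.StandingAssumptions) : ContDiff ℝ 2 P.energy := by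
  unfold RISystem.energy
  exact (contDiff_const.mul ((Matrix.toEuclideanCLM (𝕜 := ℝ) P.A).contDiff.inner ℝ
    contDiff_id)).add hP.F_smooth

lemma differentiable_energy (hP : P.StandingAssumptions) : Differentiable ℝ P.energy :=
  hP.contDiff_energy.differentiable (by simp)

lemma continuous_gradient_energy (hP : P.StandingAssumptions) : Continuous (gradient P.energy) :=
  (InnerProductSpace.toDual ℝ 𝕍).symm.continuous.comp
    (hP.contDiff_energy.continuous_fderiv (by simp))

lemma stabilityDist_eq (hP : P.StandingAssumptions) (l : ℝ → 𝕍) (s : ℝ) (z : 𝕍) :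
    P.stabilityDist l s z =
      Metric.infDist (l s - gradient P.energy z) (subdifferential P.R 0) := by
  have h1 : HasGradientAt (P.loadedEnergy l s) (gradient P.energy z - l s) z := by
    rw [hasGradientAt_iff_hasFDerivAt, map_sub]
    exact (hP.differentiable_energy z).hasGradientAt.hasFDerivAt.sub
      ((InnerProductSpace.toDual ℝ 𝕍) (l s)).hasFDerivAt
  rw [RISystem.stabilityDist, h1.gradient, neg_sub]

lemma stabilityDist_nonneg (P : RISystem d) (l : ℝ → 𝕍) (s : ℝ) (z : 𝕍) :
    0 ≤ P.stabilityDist l s z :=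
  Metric.infDist_nonneg

lemma exists_mul_sq_le_energy (hP : P.StandingAssumptions) :
    ∃ α : ℝ, 0 < α ∧ ∀ z, α * ‖z‖ ^ 2 ≤ P.energy z := by
  set q : 𝕍 → ℝ := fun z => ⟪Matrix.toEuclideanCLM (𝕜 := ℝ) P.A z, z⟫_ℝ with hq
  have hqc : Continuous q := by fun_prop
  have hqpos : ∀ z ≠ 0, 0 < q z := by
    intro z hz
    simp only [hq]
    rw [real_inner_comm, Matrix.inner_toEuclideanCLM]
    have := hP.A_posDef.dotProduct_mulVec_pos (x := z.ofLp) (by simpa using hz)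
    simpa using this
  obtain ⟨α, hα, h⟩ : ∃ α : ℝ, 0 < α ∧ ∀ z, ‖z‖ = 1 → α ≤ q z := by
    rcases (Metric.sphere (0 : 𝕍) 1).eq_empty_or_nonempty with he | hne
    · refine ⟨1, one_pos, fun z hz => ?_⟩
      have : z ∈ Metric.sphere (0 : 𝕍) 1 := by simpa using hz
      simp [he] at this
    · obtain ⟨x, hx, hmin⟩ := (isCompact_sphere (0 : 𝕍) 1).exists_isMinOn hne hqc.continuousOn
      have hx1 : ‖x‖ = 1 := by simpa using hx
      refine ⟨q x, hqpos x (norm_ne_zero_iff.1 (by rw [hx1]; exact one_ne_zero)), fun z hz => ?_⟩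
      exact hmin (by simpa using hz : z ∈ Metric.sphere (0 : 𝕍) 1)
  refine ⟨α / 2, by positivity, fun z => ?_⟩
  have hqz : α * ‖z‖ ^ 2 ≤ q z := by
    rcases eq_or_ne z 0 with rfl | hz
    · simp [hq]
    have hn : ‖z‖ ≠ 0 := norm_ne_zero_iff.2 hz
    have h1 := h (‖z‖⁻¹ • z) (by rw [norm_smul, norm_inv, norm_norm, inv_mul_cancel₀ hn])
    simp only [hq, map_smul, inner_smul_left, inner_smul_right, conj_trivial] at h1
    have h2 : ‖z‖ ^ 2 * (‖z‖⁻¹ * (‖z‖⁻¹ * q z)) = q z := by field_simp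
    have h3 := mul_le_mul_of_nonneg_left h1 (sq_nonneg ‖z‖)
    rw [mul_comm α]
    exact h3.trans_eq h2
  have := hP.F_nonneg z
  simp only [RISystem.energy]
  simp only [hq] at hqz
  linarith

/-- The chain rule for the energy along a Lipschitz curve. -/
lemma integral_inner_gradient_deriv (hP : P.StandingAssumptions) {z : ℝ → 𝕍} {L : ℝ≥0} {B : ℝ}
    (hz : LipschitzWith L z) (hB : ∀ x, ‖z x‖ ≤ B) (a b : ℝ) :
    ∫ s in a..b, ⟪gradient P.energy (z s), deriv z s⟫_ℝ = P.energy (z b) - P.energy (z a) := by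
  obtain ⟨C, hC⟩ := (isCompact_closedBall (0 : 𝕍) B).exists_bound_of_continuousOn
    (hP.contDiff_energy.continuous_fderiv (by simp)).continuousOn
  have hlip : LipschitzOnWith (Real.toNNReal C) P.energy (Metric.closedBall 0 B) := by
    refine (convex_closedBall (0 : 𝕍) B).lipschitzOnWith_of_nnnorm_fderiv_le (𝕜 := ℝ)
      (fun x _ => hP.differentiable_energy x) fun x hx => ?_
    rw [← NNReal.coe_le_coe, coe_nnnorm]
    exact (hC x hx).trans (Real.le_coe_toNNReal C)
  have hcomp : LipschitzWith (Real.toNNReal C * L) (P.energy ∘ z) := by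
    rw [← lipschitzOnWith_univ]
    exact hlip.comp hz.lipschitzOnWith fun x _ => by simpa using hB x
  have h1 := hcomp.integral_deriv_eq_sub a b
  simp only [Function.comp] at h1
  rw [← h1]
  refine intervalIntegral.integral_congr_ae ?_
  filter_upwards [hz.ae_differentiableAt_real] with s hs _
  have h2 := (hP.differentiable_energy (z s)).hasGradientAt.hasFDerivAt.comp_hasDerivAt s
    hs.hasDerivAt
  rw [h2.deriv, InnerProductSpace.toDual_apply_apply]

end RISystem.StandingAssumptions

/-! ### Extension of functions on `[0, S]` to the real line -/

/-- The extension of a function on `[0, S]` to `ℝ` by the constants `f 0` and `f S`. It agrees with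
`constExt S f` on `[0, ∞)`. -/
def clampExt {V : Type*} (S : ℝ) (f : ℝ → V) : ℝ → V := fun x => f (max 0 (min x S))

section ClampExt

variable {V : Type*} {S : ℝ} {f : ℝ → V}

lemma max_zero_min_mem_Icc (hS : 0 ≤ S) (x : ℝ) : max 0 (min x S) ∈ Icc 0 S :=
  ⟨le_max_left _ _, max_le hS (min_le_right _ _)⟩

lemma clampExt_of_mem {x : ℝ} (hx : x ∈ Icc 0 S) : clampExt S f x = f x := by
  rw [clampExt, min_eq_left hx.2, max_eq_right hx.1]

lemma constExt_eq_clampExt (hS : 0 ≤ S) {x : ℝ} (hx : 0 ≤ x) :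
    constExt S f x = clampExt S f x := by
  rw [constExt, clampExt, max_eq_right (le_min hx hS)]

lemma clampExt_max_min (hS : 0 ≤ S) (x : ℝ) :
    clampExt S f (max 0 (min x S)) = clampExt S f x :=
  clampExt_of_mem (max_zero_min_mem_Icc hS x)

lemma monotone_max_zero_min (S : ℝ) : Monotone fun x : ℝ => max 0 (min x S) := fun _ _ hxy =>
  max_le_max le_rfl (min_le_min hxy le_rfl)

lemma eVariationOn_clampExt_le [PseudoEMetricSpace V] (hS : 0 ≤ S) :
    eVariationOn (clampExt S f) univ ≤ eVariationOn f (Icc 0 S) :=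
  eVariationOn.comp_le_of_monotoneOn f (fun x : ℝ => max 0 (min x S))
    ((monotone_max_zero_min S).monotoneOn _) fun x _ => max_zero_min_mem_Icc hS x

/-- A function in `W^{1,∞}(0, S)` extends to a Lipschitz function on `ℝ`, whose pointwise
derivative is the weak derivative. -/
lemma HasW1infDeriv.lipschitzWith_clampExt [NormedAddCommGroup V] [InnerProductSpace ℝ V]
    [FiniteDimensional ℝ V] {f' : ℝ → V} {L : ℝ≥0} (h : HasW1infDeriv S f f') (hS : 0 < S)
    (hc : ContinuousOn f (Icc 0 S)) (hL : ∀ᵐ s ∂(lebesgueOn S), ‖f' s‖ ≤ L) :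
    LipschitzWith L (clampExt S f) ∧
      ∀ᵐ s ∂(lebesgueOn S), deriv (clampExt S f) s = f' s := by
  have hL' : ∀ᵐ s, s ∈ Ioo 0 S → ‖f' s‖ ≤ L := (ae_restrict_iff' measurableSet_Ioo).1 hL
  have hne : ∀ᵐ s : ℝ, s ≠ S := by simp [ae_iff, measure_singleton]
  have hLip : LipschitzOnWith L f (Icc 0 S) := by
    refine LipschitzOnWith.of_dist_le_mul fun x hx y hy => ?_
    rw [dist_eq_norm, h.sub_eq_integral hS hc hy hx, Real.dist_eq]
    refine intervalIntegral.norm_integral_le_of_norm_le_const_ae ?_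
    filter_upwards [hL', hne] with s hs hsS hs'
    refine hs ⟨?_, lt_of_le_of_ne ?_ hsS⟩
    · rw [mem_uIoc] at hs'
      rcases hs' with hs' | hs'
      exacts [hy.1.trans_lt hs'.1, hx.1.trans_lt hs'.1]
    · rw [mem_uIoc] at hs'
      rcases hs' with hs' | hs'
      exacts [hs'.2.trans hx.2, hs'.2.trans hy.2]
  refine ⟨LipschitzWith.of_dist_le_mul fun x y => ?_, ?_⟩
  · refine (hLip.dist_le_mul _ (max_zero_min_mem_Icc hS.le x) _
      (max_zero_min_mem_Icc hS.le y)).trans (mul_le_mul_of_nonneg_left ?_ L.2)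
    rw [Real.dist_eq, Real.dist_eq]
    refine (abs_max_sub_max_le_max _ _ _ _).trans ?_
    rw [sub_self, abs_zero]
    refine max_le (abs_nonneg _) ((abs_min_sub_min_le_max _ _ _ _).trans ?_)
    rw [sub_self, abs_zero]
    exact max_le le_rfl (abs_nonneg _)
  · have hi : IntervalIntegrable f' volume 0 S := by
      rw [intervalIntegrable_iff_integrableOn_Ioo_of_le hS.le]
      exact h.memLp_deriv.integrable le_top
    rw [lebesgueOn, ae_restrict_iff' measurableSet_Ioo]
    filter_upwards [hi.ae_hasDerivAt_integral] with s hs hsS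
    rw [uIcc_of_le hS.le] at hs
    have h1 := ((hs (Ioo_subset_Icc_self hsS) 0 (left_mem_Icc.2 hS.le)).const_add (f 0))
    refine (h1.congr_of_eventuallyEq ?_).deriv
    filter_upwards [Ioo_mem_nhds hsS.1 hsS.2] with x hx
    rw [clampExt_of_mem (Ioo_subset_Icc_self hx),
      ← h.sub_eq_integral hS hc (left_mem_Icc.2 hS.le) (Ioo_subset_Icc_self hx)]
    abel

/-- A function is bounded by its `BV` norm. -/
lemma norm_le_of_bvNorm_le [NormedAddCommGroup V] {K : ℝ≥0} {T : ℝ} (hT : 0 < T) (hTS : T ≤ S)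
    (hf : bvNorm S f ≤ K) {x : ℝ} (hx : x ∈ Icc 0 S) : ‖f x‖ ≤ K / T + K := by
  have hS : 0 < S := hT.trans_le hTS
  have hvar : eVariationOn f (Icc 0 S) ≤ K := le_add_self.trans hf
  have hL1 : ∫⁻ s in Ioo 0 S, ‖f s‖ₑ ≤ K := by
    have := (le_self_add.trans hf : eLpNorm f 1 (lebesgueOn S) ≤ K)
    rwa [eLpNorm_one_eq_lintegral_enorm] at this
  have hpt : ∀ s ∈ Ioo 0 S, ‖f x‖ₑ ≤ ‖f s‖ₑ + K := by
    intro s hs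
    have h1 : edist (f x) (f s) ≤ K :=
      (eVariationOn.edist_le f hx (Ioo_subset_Icc_self hs)).trans hvar
    rw [edist_eq_enorm_sub] at h1
    calc ‖f x‖ₑ = ‖f s + (f x - f s)‖ₑ := by rw [add_sub_cancel]
      _ ≤ ‖f s‖ₑ + ‖f x - f s‖ₑ := enorm_add_le _ _
      _ ≤ _ := by gcongr
  have h2 : ‖f x‖ₑ * ENNReal.ofReal S ≤ K + K * ENNReal.ofReal S := by
    calc ‖f x‖ₑ * ENNReal.ofReal S = ∫⁻ _ in Ioo 0 S, ‖f x‖ₑ := by simp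
      _ ≤ ∫⁻ s in Ioo 0 S, (‖f s‖ₑ + K) := setLIntegral_mono' measurableSet_Ioo hpt
      _ = (∫⁻ s in Ioo 0 S, ‖f s‖ₑ) + K * ENNReal.ofReal S := by
          rw [lintegral_add_right _ measurable_const]; simp
      _ ≤ _ := by gcongr
  have h3 : ‖f x‖ * S ≤ K + K * S := by
    have := ENNReal.toReal_mono (by finiteness) h2
    rw [ENNReal.toReal_add (by finiteness) (by finiteness), ENNReal.toReal_mul,
      ENNReal.toReal_mul, ENNReal.toReal_ofReal hS.le] at this
    simpa using this
  have h4 : ‖f x‖ ≤ K / S + K := by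
    refine le_of_mul_le_mul_right (h3.trans_eq ?_) hS
    field_simp
  refine h4.trans ?_
  gcongr

end ClampExt

/-! ### Relaxed solutions as Lipschitz curves on the real line -/

namespace RISystem

variable {d : ℕ} {P : RISystem d}

local notation "𝕍" => EuclideanSpace ℝ (Fin d)

/-- The content of the conditions on a relaxed solution for functions `t, z, lh` that are defined on
all of `ℝ`, with `t` and `z` Lipschitz and with pointwise derivatives in place of the weak ones.
The dissipation integral of the energy identity is eliminated by means of the normalization, and the
compatibility condition is only kept at the points with `t' > 0`. -/
structure IsLipschitzSolution (P : RISystem d) (c : ℝ≥0) (l : ℝ → 𝕍) (S : ℝ) (t : ℝ → ℝ)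
    (z lh : ℝ → 𝕍) : Prop where
  S_pos : 0 < S
  t_lip : LipschitzWith 1 t
  z_lip : LipschitzWith c z
  t_clamp : ∀ x, t (max 0 (min x S)) = t x
  z_clamp : ∀ x, z (max 0 (min x S)) = z x
  t_zero : t 0 = 0
  t_end : t S = P.T
  z_zero : z 0 = P.z₀
  t_mono : Monotone t
  complementarity : ∀ᵐ s, s ∈ Ioo 0 S → deriv t s * P.stabilityDist lh s (z s) = 0
  normalization : ∀ᵐ s, s ∈ Ioo 0 S →
    deriv t s + P.R (deriv z s) + ‖deriv z s‖ * P.stabilityDist lh s (z s) = 1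
  energy_identity : ∀ a ∈ Icc 0 S, ∀ b ∈ Icc 0 S, a ≤ b →
    P.energy (z b) + ((b - a) - (t b - t a)) = P.energy (z a) + ∫ r in a..b, ⟪lh r, deriv z r⟫_ℝ
  compatibility : ∀ᵐ s, s ∈ Ioo 0 S → 0 < deriv t s → lh s = l (t s)

lemma mem_increasePoints_of_deriv_pos {S : ℝ} {t : ℝ → ℝ} (ht : Monotone t) {s : ℝ}
    (hs : s ∈ Ioo 0 S) (hd : 0 < deriv t s) : s ∈ increasePoints S t := by
  have hdiff : DifferentiableAt ℝ t s := differentiableAt_of_deriv_ne_zero hd.ne'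
  refine ⟨hs, fun s₁ _ s₂ _ h₁ h₂ => lt_of_le_of_ne (ht (h₁.trans h₂).le) fun heq => hd.ne' ?_⟩
  -- Otherwise `t` would be constant on the neighbourhood `(s₁, s₂)` of `s`.
  have hconst : t =ᶠ[𝓝 s] fun _ => t s₁ := by
    filter_upwards [Ioo_mem_nhds h₁ h₂] with x hx
    exact le_antisymm ((ht hx.2.le).trans heq.ge) (ht hx.1.le)
  rw [hconst.deriv_eq, deriv_const]

lemma increasePoints_congr {S : ℝ} {t u : ℝ → ℝ} (h : EqOn t u (Icc 0 S)) :
    increasePoints S t = increasePoints S u := by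
  ext s
  refine and_congr_right fun _ => forall₂_congr fun s₁ h₁ => forall₂_congr fun s₂ h₂ => ?_
  rw [h h₁, h h₂]

/-- A relaxed solution extends to a Lipschitz solution on the real line. -/
lemma StandingAssumptions.exists_isLipschitzSolution (hP : P.StandingAssumptions) :
    ∃ c : ℝ≥0, ∀ (l : ℝ → 𝕍) (S : ℝ) (t : ℝ → ℝ) (z lh : ℝ → 𝕍), P.IsRelaxedSolution l S t z lh →
      P.IsLipschitzSolution c (clampExt P.T l) S (clampExt S t) (clampExt S z) (clampExt S lh) := by
  obtain ⟨c, C, hc, -, hR⟩ := hP.R_bounds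
  refine ⟨Real.toNNReal c⁻¹, ?_⟩
  rintro l S t z lh ⟨t', z', h⟩
  have hS : 0 < S := h.S_pos
  have hnn (s : ℝ) : 0 ≤ ‖z' s‖ * P.stabilityDist lh s (z s) :=
    mul_nonneg (norm_nonneg _) (stabilityDist_nonneg P _ _ _)
  have ht' : ∀ᵐ s ∂(lebesgueOn S), ‖t' s‖ ≤ (1 : ℝ≥0) := by
    filter_upwards [h.monotone, h.normalization] with s h1 h2
    rw [Real.norm_of_nonneg h1]
    have := hP.R_nonneg (z' s)
    have := hnn s
    push_cast
    linarith
  have hz' : ∀ᵐ s ∂(lebesgueOn S), ‖z' s‖ ≤ Real.toNNReal c⁻¹ := by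
    filter_upwards [h.monotone, h.normalization] with s h1 h2
    rw [Real.coe_toNNReal _ (by positivity), ← one_div, le_div_iff₀ hc, mul_comm]
    have := (hR (z' s)).1
    have := hnn s
    linarith
  obtain ⟨htL, htd⟩ := h.t_w1inf.lipschitzWith_clampExt hS h.t_cont ht'
  obtain ⟨hzL, hzd⟩ := h.z_w1inf.lipschitzWith_clampExt hS h.z_cont hz'
  have hdist {s : ℝ} (hs : s ∈ Ioo 0 S) : P.stabilityDist (clampExt S lh) s (clampExt S z s) =
      P.stabilityDist lh s (z s) := by
    rw [hP.stabilityDist_eq, hP.stabilityDist_eq, clampExt_of_mem (Ioo_subset_Icc_self hs),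
      clampExt_of_mem (Ioo_subset_Icc_self hs)]
  have h0 : (0 : ℝ) ∈ Icc 0 S := left_mem_Icc.2 hS.le
  have hS' : S ∈ Icc 0 S := right_mem_Icc.2 hS.le
  have haeI {p : ℝ → Prop} (hp : ∀ᵐ s ∂(lebesgueOn S), p s) {a b : ℝ} (ha : a ∈ Icc 0 S)
      (hb : b ∈ Icc 0 S) (hab : a ≤ b) : ∀ᵐ s, s ∈ uIoc a b → p s := by
    have hne : ∀ᵐ s : ℝ, s ≠ S := by simp [ae_iff, measure_singleton]
    filter_upwards [(ae_restrict_iff' measurableSet_Ioo).1 hp, hne] with s hs hsS hs'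
    rw [uIoc_of_le hab] at hs'
    exact hs ⟨ha.1.trans_lt hs'.1, lt_of_le_of_ne (hs'.2.trans hb.2) hsS⟩
  have htmono : MonotoneOn t (Icc 0 S) := by
    intro a ha b hb hab
    rw [← sub_nonneg, h.t_w1inf.sub_eq_integral hS h.t_cont ha hb]
    refine intervalIntegral.integral_nonneg_of_ae_restrict hab ?_
    rw [← restrict_Ioc_eq_restrict_Icc, EventuallyLE, ae_restrict_iff' measurableSet_Ioc,
      ← uIoc_of_le hab]
    exact haeI h.monotone ha hb hab
  have htmono' : Monotone (clampExt S t) := fun x y hxy =>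
    htmono (max_zero_min_mem_Icc hS.le x) (max_zero_min_mem_Icc hS.le y)
      (monotone_max_zero_min S hxy)
  refine
    { S_pos := hS
      t_lip := htL
      z_lip := hzL
      t_clamp := clampExt_max_min hS.le
      z_clamp := clampExt_max_min hS.le
      t_zero := by rw [clampExt_of_mem h0, h.t_zero]
      t_end := by rw [clampExt_of_mem hS', h.t_end]
      z_zero := by rw [clampExt_of_mem h0, h.z_zero]
      t_mono := htmono'
      complementarity := ?_
      normalization := ?_
      energy_identity := ?_
      compatibility := ?_ }
  · refine (ae_restrict_iff' measurableSet_Ioo).1 ?_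
    filter_upwards [h.complementarity, htd, ae_restrict_mem measurableSet_Ioo] with s h1 h2 hs
    rw [h2, hdist hs, h1]
  · refine (ae_restrict_iff' measurableSet_Ioo).1 ?_
    filter_upwards [h.normalization, htd, hzd, ae_restrict_mem measurableSet_Ioo] with s h1 h2 h3 hs
    rw [h2, h3, hdist hs, h1]
  · intro a ha b hb hab
    have h1 := h.energy_identity a ha b hb
    have hti : IntervalIntegrable t' volume a b := by
      rw [intervalIntegrable_iff_integrableOn_Ioo_of_le hab]
      have : IntegrableOn t' (Ioo 0 S) := h.t_w1inf.memLp_deriv.integrable le_top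
      exact this.mono_set (Ioo_subset_Ioo ha.1 hb.2)
    have h2 : ∫ r in a..b, (P.R (z' r) + ‖z' r‖ * P.stabilityDist lh r (z r)) =
        (b - a) - (t b - t a) := by
      have hone : ∫ _ in a..b, (1 : ℝ) = b - a := by simp
      rw [h.t_w1inf.sub_eq_integral hS h.t_cont ha hb, ← hone,
        ← intervalIntegral.integral_sub intervalIntegrable_const hti]
      refine intervalIntegral.integral_congr_ae ?_
      filter_upwards [haeI h.normalization ha hb hab] with s hs hs'
      linarith [hs hs']
    have h3 : ∫ r in a..b, ⟪clampExt S lh r, deriv (clampExt S z) r⟫_ℝ =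
        ∫ r in a..b, ⟪lh r, z' r⟫_ℝ := by
      refine intervalIntegral.integral_congr_ae ?_
      filter_upwards [haeI hzd ha hb hab] with s hs hs'
      rw [hs hs', clampExt_of_mem]
      rw [uIoc_of_le hab] at hs'
      exact ⟨ha.1.trans hs'.1.le, hs'.2.trans hb.2⟩
    rw [clampExt_of_mem ha, clampExt_of_mem hb, clampExt_of_mem ha, clampExt_of_mem hb, h3, ← h2,
      h1]
  · filter_upwards [h.compatibility] with s hs hsS hd
    have h1 : s ∈ increasePoints S t := by
      rw [← increasePoints_congr fun x hx => clampExt_of_mem hx]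
      exact mem_increasePoints_of_deriv_pos htmono' hsS hd
    have hsI := Ioo_subset_Icc_self hsS
    rw [clampExt_of_mem hsI, clampExt_of_mem hsI, hs h1, clampExt_of_mem]
    exact ⟨h.t_zero ▸ htmono h0 hsI hsI.1, h.t_end ▸ htmono hsI hS' hsI.2⟩

namespace IsLipschitzSolution

variable {c : ℝ≥0} {l : ℝ → EuclideanSpace ℝ (Fin d)} {S : ℝ} {t : ℝ → ℝ}
  {z lh : ℝ → EuclideanSpace ℝ (Fin d)}

lemma T_le (h : P.IsLipschitzSolution c l S t z lh) : P.T ≤ S := by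
  have h1 := h.t_lip.dist_le_mul S 0
  rw [h.t_end, h.t_zero, dist_zero_right, dist_zero_right, Real.norm_of_nonneg h.S_pos.le] at h1
  have := Real.le_norm_self P.T
  push_cast at h1
  linarith

lemma sub_le_sub (h : P.IsLipschitzSolution c l S t z lh) {a b : ℝ} (hab : a ≤ b) :
    t b - t a ≤ b - a := by
  have h1 := h.t_lip.dist_le_mul b a
  rw [Real.dist_eq, Real.dist_eq, abs_of_nonneg (sub_nonneg.2 hab)] at h1
  have := le_abs_self (t b - t a)
  push_cast at h1
  linarith

lemma norm_t_le (h : P.IsLipschitzSolution c l S t z lh) (x : ℝ) : ‖t x‖ ≤ P.T := by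
  have hm := max_zero_min_mem_Icc h.S_pos.le x
  rw [← h.t_clamp x, Real.norm_eq_abs, abs_le]
  have h1 := h.t_mono hm.1
  have h2 := h.t_mono hm.2
  rw [h.t_zero] at h1
  rw [h.t_end] at h2
  constructor <;> linarith

end IsLipschitzSolution

/-- A priori bounds: the curves and the lengths of the parameter intervals are bounded in terms of
the bounds on the loads. The work of the load is integrated by parts, so that it grows linearly in
`sup ‖z‖`, whereas the energy grows quadratically. -/
lemma StandingAssumptions.exists_bound (hP : P.StandingAssumptions) (c K : ℝ≥0) {B : ℝ}
    (hB0 : 0 ≤ B) :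
    ∃ C : ℝ, ∀ (l : ℝ → 𝕍) (S : ℝ) (t : ℝ → ℝ) (z lh : ℝ → 𝕍),
      P.IsLipschitzSolution c l S t z lh → eVariationOn lh univ ≤ K → (∀ x, ‖lh x‖ ≤ B) →
      S ≤ C ∧ ∀ x, ‖z x‖ ≤ C := by
  obtain ⟨α, hα, hE⟩ := hP.exists_mul_sq_le_energy
  have hE0 : ∀ v, 0 ≤ P.energy v := fun v => (by positivity : 0 ≤ α * ‖v‖ ^ 2).trans (hE v)
  set a : ℝ := P.energy P.z₀ + B * ‖P.z₀‖ with ha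
  have ha0 : 0 ≤ a := by have := hE0 P.z₀; positivity
  set M₀ : ℝ := max 1 ((a + (B + K)) / α) with hM₀
  refine ⟨max M₀ (P.T + a + (B + K) * M₀), fun l S t z lh h hvar hB => ?_⟩
  -- The maximum of `‖z‖` over `[0, S]` is attained at `s`.
  obtain ⟨s, hs, hmax⟩ := isCompact_Icc.exists_isMaxOn (nonempty_Icc.2 h.S_pos.le)
    h.z_lip.continuous.norm.continuousOn
  have hM : ∀ x ∈ Icc 0 S, ‖z x‖ ≤ ‖z s‖ := fun x hx => hmax hx
  have h0 : (0 : ℝ) ∈ Icc 0 S := left_mem_Icc.2 h.S_pos.le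
  have hwork : ∀ x ∈ Icc 0 S, ∫ r in (0 : ℝ)..x, ⟪lh r, deriv z r⟫_ℝ ≤
      B * ‖P.z₀‖ + (B + K) * ‖z s‖ := by
    intro x hx
    have h1 := abs_integral_inner_deriv_sub_le hvar hB h.z_lip hx.1
      (M := ‖z s‖) fun y hy => hM y ⟨hy.1, hy.2.trans hx.2⟩
    have h2 := (abs_le.1 h1).2
    have h3 : ⟪lh x, z x⟫_ℝ ≤ B * ‖z s‖ := (real_inner_le_norm _ _).trans
      (mul_le_mul (hB x) (hM x hx) (norm_nonneg _) hB0)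
    have h4 : -⟪lh 0, z 0⟫_ℝ ≤ B * ‖P.z₀‖ := by
      rw [← inner_neg_left, h.z_zero]
      refine (real_inner_le_norm _ _).trans ?_
      rw [norm_neg]
      exact mul_le_mul_of_nonneg_right (hB 0) (norm_nonneg _)
    linarith
  have hen : ∀ x ∈ Icc 0 S, P.energy (z x) + ((x - 0) - (t x - t 0)) ≤ a + (B + K) * ‖z s‖ := by
    intro x hx
    rw [h.energy_identity 0 h0 x hx hx.1, h.z_zero]
    linarith [hwork x hx]
  have hzs : ‖z s‖ ≤ M₀ := by
    by_contra! hlt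
    have h1 : 1 < ‖z s‖ := (le_max_left _ _).trans_lt hlt
    have h2 : (a + (B + K)) / α < ‖z s‖ := (le_max_right _ _).trans_lt hlt
    rw [div_lt_iff₀ hα] at h2
    have h3 := hE (z s)
    have h4 := hen s hs
    have h5 := h.sub_le_sub hs.1
    have h6 : α * ‖z s‖ ^ 2 ≤ a + (B + K) * ‖z s‖ := by linarith
    have h7 : (a + (B + K)) * ‖z s‖ < ‖z s‖ * α * ‖z s‖ :=
      mul_lt_mul_of_pos_right h2 (by linarith)
    nlinarith
  constructor
  · refine le_max_of_le_right ?_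
    have h1 := hen S (right_mem_Icc.2 h.S_pos.le)
    rw [h.t_end, h.t_zero] at h1
    have h2 := hE0 (z S)
    have h3 : (B + K) * ‖z s‖ ≤ (B + K) * M₀ := by gcongr
    linarith
  · intro x
    rw [← h.z_clamp x]
    exact le_max_of_le_left ((hM _ (max_zero_min_mem_Icc h.S_pos.le x)).trans hzs)

end RISystem

/-! ### Passage to the limit -/

/-- Almost everywhere nonnegativity is stable under convergence of the integrals over intervals. -/
lemma ae_nonneg_of_tendsto_intervalIntegral {p : ℕ → ℝ → ℝ} {q : ℝ → ℝ} {S : ℕ → ℝ} {S' : ℝ}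
    (hS : Tendsto S atTop (𝓝 S')) (hq : LocallyIntegrable q)
    (hp : ∀ n, ∀ᵐ s, s ∈ Ioo 0 (S n) → 0 ≤ p n s)
    (h : ∀ a b, 0 < a → a < b → b < S' →
      Tendsto (fun n => ∫ s in a..b, p n s) atTop (𝓝 (∫ s in a..b, q s))) :
    ∀ᵐ s, s ∈ Ioo 0 S' → 0 ≤ q s := by
  refine ae_nonneg_of_intervalIntegral_nonneg hq fun a b ha hab hb => ?_
  refine ge_of_tendsto (h a b ha hab hb) ?_
  filter_upwards [hS.eventually_const_lt hb] with n hn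
  refine intervalIntegral.integral_nonneg_of_ae_restrict hab.le ?_
  rw [EventuallyLE, ae_restrict_iff' measurableSet_Icc]
  filter_upwards [hp n] with s hs hs'
  exact hs ⟨ha.trans_le hs'.1, hs'.2.trans_lt hn⟩

lemma locallyIntegrable_of_norm_le {V : Type*} [NormedAddCommGroup V] {f : ℝ → V} {D : ℝ}
    (hf : StronglyMeasurable f) (hD : ∀ x, ‖f x‖ ≤ D) : LocallyIntegrable f := by
  refine MeasureTheory.LocallyIntegrable.mono (f := fun _ => D) (locallyIntegrable_const _)
    hf.aestronglyMeasurable (.of_forall fun x => (hD x).trans (Real.le_norm_self D))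

namespace RISystem

variable {d : ℕ} {P : RISystem d}

local notation "𝕍" => EuclideanSpace ℝ (Fin d)

/-- Each value is taken at two increase points at most: `t` would take equal values on either side
of the middle one of three. -/
lemma countable_increasePoints_inter_preimage {S : ℝ} {t : ℝ → ℝ} {D : Set ℝ}
    (hD : D.Countable) : (increasePoints S t ∩ t ⁻¹' D).Countable := by
  have hτ (τ : ℝ) : (increasePoints S t ∩ t ⁻¹' {τ}).Countable := by
    set A := increasePoints S t ∩ t ⁻¹' {τ} with hA
    have hsub : A ⊆ {x ∈ A | ∀ y ∈ A, y ≤ x} ∪ {x ∈ A | ∀ y ∈ A, x ≤ y} := by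
      intro x hx
      by_contra hcon
      rw [mem_union, not_or] at hcon
      simp only [mem_ofPred_eq, hx, true_and, not_forall, not_le] at hcon
      obtain ⟨⟨z, hz, hxz⟩, ⟨y, hy, hyx⟩⟩ := hcon
      have := hx.1.2 y (Ioo_subset_Icc_self hy.1.1) z (Ioo_subset_Icc_self hz.1.1) hyx hxz
      rw [hy.2, hz.2] at this
      exact lt_irrefl _ this
    refine Countable.mono hsub (Countable.union (Subsingleton.countable ?_)
      (Subsingleton.countable ?_))
    · exact fun x hx y hy => le_antisymm (hy.2 x hx.1) (hx.2 y hy.1)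
    · exact fun x hx y hy => le_antisymm (hx.2 y hy.1) (hy.2 x hx.1)
  have : increasePoints S t ∩ t ⁻¹' D = ⋃ τ ∈ D, increasePoints S t ∩ t ⁻¹' {τ} := by
    ext x; simp
  rw [this]
  exact hD.biUnion fun τ _ => hτ τ

/-- Stability of the compatibility condition. Close to an increase point `s` of the limit, `t n` has
a nonzero increment, hence a point `r` with `(t n)' r > 0`, where the condition holds for `n`; the
asymptotic equicontinuity of the loads carries it over to `s`. -/
lemma compatibility_of_tendsto {c : ℝ≥0} {l : ℕ → ℝ → 𝕍} {S : ℕ → ℝ} {t : ℕ → ℝ → ℝ}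
    {z lh : ℕ → ℝ → 𝕍} (hsol : ∀ n, P.IsLipschitzSolution c (l n) (S n) (t n) (z n) (lh n))
    {l' : ℝ → 𝕍} {S' : ℝ} {t' : ℝ → ℝ} {lh' : ℝ → 𝕍}
    (hS : Tendsto S atTop (𝓝 S')) (ht : ∀ x, Tendsto (fun n => t n x) atTop (𝓝 (t' x)))
    (hl : ∀ x, Tendsto (fun n => l n x) atTop (𝓝 (l' x)))
    (hlh : ∀ x, Tendsto (fun n => lh n x) atTop (𝓝 (lh' x)))
    {s : ℝ} (hs : s ∈ increasePoints S' t')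
    (hequi : ∀ ε > 0, ∃ δ > 0, ∀ᶠ n in atTop, ∀ y, |y - s| < δ → ‖lh n y - lh n s‖ < ε)
    (hequi' : ∀ ε > 0, ∃ δ > 0, ∀ᶠ n in atTop, ∀ y, |y - t' s| < δ →
      ‖l n y - l n (t' s)‖ < ε) : lh' s = l' (t' s) := by
  have hlim : Tendsto (fun n => ‖lh n s - l n (t' s)‖) atTop (𝓝 ‖lh' s - l' (t' s)‖) :=
    ((hlh s).sub (hl (t' s))).norm
  rw [← sub_eq_zero, ← norm_le_zero_iff]
  refine le_of_forall_pos_le_add fun ε hε => ?_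
  rw [zero_add]
  refine le_of_tendsto hlim ?_
  obtain ⟨δ₁, hδ₁, h₁⟩ := hequi (ε / 2) (by positivity)
  obtain ⟨δ₂, hδ₂, h₂⟩ := hequi' (ε / 2) (by positivity)
  obtain ⟨⟨hs0, hsS⟩, hinc⟩ := hs
  obtain ⟨δ, hδ, hδlt⟩ := exists_between
    (show 0 < min (min δ₁ (δ₂ / 2)) (min s (S' - s)) from
      lt_min (lt_min hδ₁ (by positivity)) (lt_min hs0 (sub_pos.2 hsS)))
  simp only [lt_min_iff] at hδlt
  obtain ⟨⟨hd1, hd2⟩, hd3, hd4⟩ := hδlt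
  have hlt := hinc (s - δ) ⟨by linarith, by linarith⟩ (s + δ) ⟨by linarith, by linarith⟩
    (by linarith) (by linarith)
  filter_upwards [h₁, h₂, hS.eventually_const_lt (show s + δ < S' by linarith),
    (ht (s - δ)).eventually_lt (ht (s + δ)) hlt,
    Metric.tendsto_nhds.1 (ht s) (δ₂ / 2) (by positivity)] with n h₁ h₂ hSn htn htsn
  obtain ⟨r, hr, hpos, hcomp⟩ : ∃ r ∈ Ioo (s - δ) (s + δ), 0 < deriv (t n) r ∧
      lh n r = l n (t n r) := by
    by_contra! hcon
    have hle : ∫ r in (s - δ)..(s + δ), deriv (t n) r ≤ 0 := by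
      rw [intervalIntegral.integral_of_le (by linarith), integral_Ioc_eq_integral_Ioo]
      refine integral_nonpos_of_ae ?_
      rw [EventuallyLE, ae_restrict_iff' measurableSet_Ioo]
      filter_upwards [(hsol n).compatibility] with r hr hr'
      by_contra! hpos
      exact hcon r hr' hpos (hr ⟨by linarith [hr'.1], by linarith [hr'.2]⟩ hpos)
    rw [(hsol n).t_lip.integral_deriv_eq_sub] at hle
    linarith
  have hrs : |r - s| < δ := by rw [abs_lt]; constructor <;> linarith [hr.1, hr.2]
  have h3 := h₁ r (hrs.trans hd1)
  have h4 : |t n r - t' s| < δ₂ := by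
    have h5 := (hsol n).t_lip.dist_le_mul r s
    rw [Real.dist_eq, Real.dist_eq, NNReal.coe_one, one_mul] at h5
    rw [Real.dist_eq] at htsn
    have := abs_sub_le (t n r) (t n s) (t' s)
    linarith
  have h5 := h₂ _ h4
  rw [← hcomp] at h5
  rw [norm_sub_rev] at h3
  have := norm_sub_le_norm_sub_add_norm_sub (lh n s) (lh n r) (l n (t' s))
  linarith

/-- A pointwise limit of Lipschitz solutions with bounded loads is a relaxed solution. -/
lemma StandingAssumptions.isRelaxedSolutionWith_of_tendsto (hP : P.StandingAssumptions) {c : ℝ≥0}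
    {l : ℕ → ℝ → 𝕍} {S : ℕ → ℝ} {t : ℕ → ℝ → ℝ} {z lh : ℕ → ℝ → 𝕍}
    (hsol : ∀ n, P.IsLipschitzSolution c (l n) (S n) (t n) (z n) (lh n))
    {l' : ℝ → 𝕍} {S' : ℝ} {t' : ℝ → ℝ} {z' lh' : ℝ → 𝕍} (hS : Tendsto S atTop (𝓝 S'))
    (ht : ∀ x, Tendsto (fun n => t n x) atTop (𝓝 (t' x)))
    (hz : ∀ x, Tendsto (fun n => z n x) atTop (𝓝 (z' x)))
    (hlh : ∀ x, Tendsto (fun n => lh n x) atTop (𝓝 (lh' x)))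
    {K : ℝ≥0} {B C : ℝ} (hvar : ∀ n, eVariationOn (lh n) univ ≤ K)
    (hB : ∀ n x, ‖lh n x‖ ≤ B) (hC : ∀ n x, ‖z n x‖ ≤ C)
    (hcomp : ∀ᵐ s, s ∈ increasePoints S' t' → lh' s = l' (t' s)) :
    P.IsRelaxedSolutionWith l' S' t' z' lh' (deriv t') (deriv z') := by
  have hS' : 0 < S' := hP.T_pos.trans_le (ge_of_tendsto' hS fun n => (hsol n).T_le)
  have htL : LipschitzWith 1 t' := lipschitzWith_of_tendsto (fun n => (hsol n).t_lip) ht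
  have hzL : LipschitzWith c z' := lipschitzWith_of_tendsto (fun n => (hsol n).z_lip) hz
  have hvar' : eVariationOn lh' univ ≤ K := eVariationOn_le_of_tendsto (fun x _ => hlh x) hvar
  have hlm (n : ℕ) : StronglyMeasurable (lh n) :=
    BoundedVariationOn.stronglyMeasurable ((hvar n).trans_lt ENNReal.coe_lt_top).ne
  have htmono : Monotone t' := fun x y hxy =>
    le_of_tendsto_of_tendsto' (ht x) (ht y) fun n => (hsol n).t_mono hxy
  have hC' : ∀ x, ‖z' x‖ ≤ C := fun x => le_of_tendsto' (hz x).norm fun n => hC n x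
  -- The driving force `ξ = lh - DE(z)`, and its distance `δ` to `∂R(0)`.
  set ξ : ℕ → ℝ → 𝕍 := fun n s => lh n s - gradient P.energy (z n s) with hξ
  set ξ' : ℝ → 𝕍 := fun s => lh' s - gradient P.energy (z' s) with hξ'
  have hgc := hP.continuous_gradient_energy
  obtain ⟨G, hG⟩ := (isCompact_closedBall (0 : 𝕍) C).exists_bound_of_continuousOn hgc.continuousOn
  have hξm (n : ℕ) : StronglyMeasurable (ξ n) :=
    (hlm n).sub (hgc.comp (hsol n).z_lip.continuous).stronglyMeasurable
  have hξB (n : ℕ) (x : ℝ) : ‖ξ n x‖ ≤ B + G :=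
    (norm_sub_le _ _).trans (add_le_add (hB n x) (hG _ (by simpa using hC n x)))
  have hξlim (x : ℝ) : Tendsto (fun n => ξ n x) atTop (𝓝 (ξ' x)) :=
    (hlh x).sub ((hgc.tendsto _).comp (hz x))
  set δ : ℕ → ℝ → ℝ := fun n s => Metric.infDist (ξ n s) (subdifferential P.R 0) with hδ
  set δ' : ℝ → ℝ := fun s => Metric.infDist (ξ' s) (subdifferential P.R 0) with hδ'
  have hδm (n : ℕ) : StronglyMeasurable (δ n) :=
    (Metric.continuous_infDist_pt _).comp_stronglyMeasurable (hξm n)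
  have hδB (n : ℕ) (x : ℝ) : ‖δ n x‖ ≤ B + G := by
    rw [Real.norm_of_nonneg Metric.infDist_nonneg]
    refine (Metric.infDist_le_dist_of_mem hP.zero_mem_subdifferential).trans ?_
    rw [dist_zero_right]
    exact hξB n x
  have hδlim (x : ℝ) : Tendsto (fun n => δ n x) atTop (𝓝 (δ' x)) :=
    ((Metric.continuous_infDist_pt _).tendsto _).comp (hξlim x)
  have hξm' : StronglyMeasurable ξ' :=
    stronglyMeasurable_of_tendsto atTop hξm (tendsto_pi_nhds.2 hξlim)
  have hξB' (x : ℝ) : ‖ξ' x‖ ≤ B + G := le_of_tendsto' (hξlim x).norm fun n => hξB n x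
  have hδm' : StronglyMeasurable δ' :=
    stronglyMeasurable_of_tendsto atTop hδm (tendsto_pi_nhds.2 hδlim)
  have hδB' (x : ℝ) : ‖δ' x‖ ≤ B + G := le_of_tendsto' (hδlim x).norm fun n => hδB n x
  have hdist (s : ℝ) : P.stabilityDist lh' s (z' s) = δ' s := hP.stabilityDist_eq _ _ _
  have hdistn (n : ℕ) (s : ℝ) : P.stabilityDist (lh n) s (z n s) = δ n s :=
    hP.stabilityDist_eq _ _ _
  have htB (n : ℕ) (x : ℝ) : ‖t n x‖ ≤ P.T := (hsol n).norm_t_le x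
  have htd (s : ℝ) : 0 ≤ deriv t' s := htmono.deriv_nonneg
  have hsub (a b : ℝ) : ∫ s in a..b, (1 - deriv t' s) = (b - a) - (t' b - t' a) := by
    rw [intervalIntegral.integral_sub intervalIntegrable_const (htL.intervalIntegrable_deriv a b),
      htL.integral_deriv_eq_sub]
    simp
  have hinner {w : ℝ → 𝕍} {D : ℝ} {u : ℝ → 𝕍} (hw : StronglyMeasurable w) (hD : ∀ x, ‖w x‖ ≤ D)
      (hu : LipschitzWith c u) : LocallyIntegrable fun s => ⟪w s, deriv u s⟫_ℝ := by
    refine locallyIntegrable_of_norm_le (D := D * c) (hw.inner (stronglyMeasurable_deriv u))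
      fun x => (norm_inner_le_norm _ _).trans ?_
    exact mul_le_mul (hD x) (norm_deriv_le_of_lipschitz hu) (norm_nonneg _)
      ((norm_nonneg _).trans (hD x))
  have hone {u : ℝ → ℝ} (hu : LipschitzWith 1 u) : LocallyIntegrable fun s => 1 - deriv u s := by
    refine locallyIntegrable_of_norm_le (D := 1 + 1)
      (stronglyMeasurable_const.sub (stronglyMeasurable_deriv u)) fun x =>
        (norm_sub_le _ _).trans (add_le_add (by simp) (norm_deriv_le_of_lipschitz hu))
  have hII {g : ℝ → ℝ} (hg : LocallyIntegrable g) (a b : ℝ) : IntervalIntegrable g volume a b :=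
    (hg.integrableOn_isCompact isCompact_uIcc).intervalIntegrable
  -- Complementarity: `∫ (t n)' δ n = 0` passes to the limit.
  have hcompl : ∀ᵐ s, s ∈ Ioo 0 S' → deriv t' s * δ' s = 0 := by
    have h1 : ∀ᵐ s, s ∈ Ioo 0 S' → 0 ≤ -⟪δ' s, deriv t' s⟫_ℝ := by
      refine ae_nonneg_of_tendsto_intervalIntegral (p := fun n s => -⟪δ n s, deriv (t n) s⟫_ℝ) hS
        ?_ (fun n => ?_) fun a b _ hab _ => ?_
      · refine (locallyIntegrable_of_norm_le (D := (B + G) * 1)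
          (hδm'.inner (stronglyMeasurable_deriv t')) fun x =>
            (norm_inner_le_norm _ _).trans ?_).neg
        exact mul_le_mul (hδB' x) (norm_deriv_le_of_lipschitz htL) (norm_nonneg _)
          ((norm_nonneg _).trans (hδB' x))
      · filter_upwards [(hsol n).complementarity] with s hs hs'
        have h2 := hs hs'
        rw [hdistn] at h2
        simp [h2]
      · simp_rw [intervalIntegral.integral_neg]
        exact (tendsto_intervalIntegral_inner_deriv (fun n => (hsol n).t_lip) htB ht hδm hδB
          hδlim hab.le).neg
    filter_upwards [h1] with s hs hsS
    have h2 := hs hsS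
    simp only [RCLike.inner_apply, conj_trivial] at h2
    have h3 : 0 ≤ deriv t' s * δ' s := mul_nonneg (htd s) Metric.infDist_nonneg
    linarith
  -- Lower semicontinuity of the dissipation, tested with countably many linear functions.
  have hlsc : ∀ᵐ s, s ∈ Ioo 0 S' →
      P.R (deriv z' s) + ‖deriv z' s‖ * δ' s ≤ 1 - deriv t' s := by
    obtain ⟨u, hu, hsup⟩ := hP.exists_seq_forall_inner_le
    have h1 : ∀ i, ∀ᵐ s, s ∈ Ioo 0 S' →
        0 ≤ (1 - deriv t' s) - ⟪(u i).1 + δ' s • (u i).2, deriv z' s⟫_ℝ := by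
      intro i
      have hbd {r : ℝ} (hr : ‖r‖ ≤ B + G) : ‖(u i).1 + r • (u i).2‖ ≤ ‖(u i).1‖ + (B + G) := by
        refine (norm_add_le _ _).trans (add_le_add le_rfl ?_)
        rw [norm_smul]
        exact (mul_le_of_le_one_right (norm_nonneg _) (hu i).2).trans hr
      have hwm (n : ℕ) : StronglyMeasurable fun s => (u i).1 + δ n s • (u i).2 :=
        stronglyMeasurable_const.add ((hδm n).smul_const _)
      have hwm' : StronglyMeasurable fun s => (u i).1 + δ' s • (u i).2 :=
        stronglyMeasurable_const.add (hδm'.smul_const _)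
      refine ae_nonneg_of_tendsto_intervalIntegral
        (p := fun n s => (1 - deriv (t n) s) - ⟪(u i).1 + δ n s • (u i).2, deriv (z n) s⟫_ℝ) hS
        ((hone htL).sub (hinner hwm' (fun x => hbd (hδB' x)) hzL)) (fun n => ?_)
        fun a b _ hab _ => ?_
      · filter_upwards [(hsol n).normalization] with s hs hs'
        have h2 := hs hs'
        rw [hdistn] at h2
        have h3 := hP.mem_subdifferential_iff.1 (hu i).1 (deriv (z n) s)
        have h4 : ⟪(u i).2, deriv (z n) s⟫_ℝ ≤ ‖deriv (z n) s‖ :=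
          (real_inner_le_norm _ _).trans (mul_le_of_le_one_left (norm_nonneg _) (hu i).2)
        have h5 := mul_le_mul_of_nonneg_left h4
          (Metric.infDist_nonneg : 0 ≤ δ n s)
        rw [inner_add_left, inner_smul_left, conj_trivial]
        linarith
      · have h2 := tendsto_intervalIntegral_inner_deriv (fun n => (hsol n).z_lip) hC hz hwm
          (fun n x => hbd (hδB n x)) (v := fun s => (u i).1 + δ' s • (u i).2)
          (fun x => tendsto_const_nhds.add ((hδlim x).smul_const _)) hab.le
        rw [intervalIntegral.integral_sub (hII (hone htL) a b)
          (hII (hinner hwm' (fun x => hbd (hδB' x)) hzL) a b), hsub]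
        have h3 (n : ℕ) : ∫ s in a..b, ((1 - deriv (t n) s) -
            ⟪(u i).1 + δ n s • (u i).2, deriv (z n) s⟫_ℝ) = ((b - a) - (t n b - t n a)) -
            ∫ s in a..b, ⟪(u i).1 + δ n s • (u i).2, deriv (z n) s⟫_ℝ := by
          rw [intervalIntegral.integral_sub (hII (hone (hsol n).t_lip) a b)
            (hII (hinner (hwm n) (fun x => hbd (hδB n x)) (hsol n).z_lip) a b),
            intervalIntegral.integral_sub intervalIntegrable_const
              ((hsol n).t_lip.intervalIntegrable_deriv a b), (hsol n).t_lip.integral_deriv_eq_sub]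
          simp
        simp_rw [h3]
        exact (tendsto_const_nhds.sub ((ht b).sub (ht a))).sub h2
    filter_upwards [ae_all_iff.2 h1] with s hs hsS
    exact hsup _ _ _ fun i => by linarith [hs i hsS]
  have hlhm' : StronglyMeasurable lh' :=
    BoundedVariationOn.stronglyMeasurable (hvar'.trans_lt ENNReal.coe_lt_top).ne
  have hlhB' (x : ℝ) : ‖lh' x‖ ≤ B := le_of_tendsto' (hlh x).norm fun n => hB n x
  have hgrad : LocallyIntegrable fun s => ⟪gradient P.energy (z' s), deriv z' s⟫_ℝ :=
    hinner (hgc.comp hzL.continuous).stronglyMeasurable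
      (fun x => hG _ (by simpa using hC' x)) hzL
  have hwork (a b : ℝ) : ∫ s in a..b, ⟪ξ' s, deriv z' s⟫_ℝ =
      (∫ r in a..b, ⟪lh' r, deriv z' r⟫_ℝ) - (P.energy (z' b) - P.energy (z' a)) := by
    rw [← hP.integral_inner_gradient_deriv hzL hC' a b,
      ← intervalIntegral.integral_sub (hII (hinner hlhm' hlhB' hzL) a b) (hII hgrad a b)]
    simp only [hξ', inner_sub_left]
  -- The integrated energy identity passes to the limit; the chain rule turns it into a pointwise
  -- one.
  have hbal : ∀ᵐ s, s ∈ Ioo 0 S' → 0 ≤ ⟪ξ' s, deriv z' s⟫_ℝ - (1 - deriv t' s) := by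
    refine ae_nonneg_of_intervalIntegral_nonneg
      ((hinner hξm' hξB' hzL).sub (hone htL)) fun a b ha hab hb => ?_
    have hlim1 := tendsto_intervalIntegral_inner_deriv (fun n => (hsol n).z_lip) hC hz hlm hB hlh
      hab.le
    have hEc := hP.differentiable_energy.continuous
    have hE (x : ℝ) : Tendsto (fun n => P.energy (z n x)) atTop (𝓝 (P.energy (z' x))) :=
      (hEc.tendsto _).comp (hz x)
    have hid : P.energy (z' b) + ((b - a) - (t' b - t' a)) =
        P.energy (z' a) + ∫ r in a..b, ⟪lh' r, deriv z' r⟫_ℝ := by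
      refine tendsto_nhds_unique_of_eventuallyEq
        ((hE b).add (tendsto_const_nhds.sub ((ht b).sub (ht a)))) ((hE a).add hlim1) ?_
      filter_upwards [hS.eventually_const_lt hb] with n hn
      exact (hsol n).energy_identity a ⟨ha.le, by linarith⟩ b ⟨by linarith, hn.le⟩ hab.le
    rw [intervalIntegral.integral_sub (hII (hinner hξm' hξB' hzL) a b) (hII (hone htL) a b), hsub]
    rw [hwork]
    linarith
  have hnorm : ∀ᵐ s, s ∈ Ioo 0 S' →
      P.R (deriv z' s) + ‖deriv z' s‖ * δ' s = 1 - deriv t' s ∧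
      P.R (deriv z' s) + ‖deriv z' s‖ * δ' s = ⟪ξ' s, deriv z' s⟫_ℝ := by
    filter_upwards [hlsc, hbal] with s h1 h2 hs
    have h3 := hP.inner_le_add_infDist (ξ' s) (deriv z' s)
    have h4 := h1 hs
    have h5 := h2 hs
    simp only [hδ'] at h4 ⊢
    constructor <;> linarith
  refine
    { S_pos := hS'
      t_cont := htL.continuous.continuousOn
      z_cont := hzL.continuous.continuousOn
      t_w1inf := htL.hasW1infDeriv hS'.le
      z_w1inf := hzL.hasW1infDeriv hS'.le
      lh_bv := ((eVariationOn.mono _ (subset_univ _)).trans hvar').trans_lt ENNReal.coe_lt_top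
      t_zero := ?_
      t_end := ?_
      z_zero := ?_
      monotone := .of_forall htd
      complementarity := ?_
      normalization := ?_
      energy_identity := ?_
      compatibility := hcomp }
  · exact tendsto_nhds_unique (ht 0) (by simp_rw [(hsol _).t_zero]; exact tendsto_const_nhds)
  · have h1 : Tendsto (fun n => t n S' - t n (S n)) atTop (𝓝 0) := by
      have h2 : Tendsto (fun n => dist S' (S n)) atTop (𝓝 0) := by
        simpa using (tendsto_const_nhds (x := S')).dist hS
      refine squeeze_zero_norm (fun n => ?_) h2
      have := (hsol n).t_lip.dist_le_mul S' (S n)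
      rwa [NNReal.coe_one, one_mul, dist_eq_norm] at this
    simp_rw [(hsol _).t_end] at h1
    have h2 := tendsto_nhds_unique h1 ((ht S').sub_const P.T)
    linarith
  · exact tendsto_nhds_unique (hz 0) (by simp_rw [(hsol _).z_zero]; exact tendsto_const_nhds)
  · rw [lebesgueOn, ae_restrict_iff' measurableSet_Ioo]
    simpa only [hdist] using hcompl
  · rw [lebesgueOn, ae_restrict_iff' measurableSet_Ioo]
    filter_upwards [hnorm] with s hs hsS
    rw [hdist]
    linarith [(hs hsS).1]
  · intro a ha b hb
    have h1 : ∫ r in a..b, (P.R (deriv z' r) + ‖deriv z' r‖ * P.stabilityDist lh' r (z' r)) =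
        ∫ r in a..b, ⟪ξ' r, deriv z' r⟫_ℝ := by
      refine intervalIntegral.integral_congr_ae ?_
      have hne : ∀ᵐ s : ℝ, s ≠ S' := by simp [ae_iff, measure_singleton]
      filter_upwards [hnorm, hne] with s hs hsS hs'
      rw [hdist]
      refine (hs ?_).2
      rw [mem_uIoc] at hs'
      rcases hs' with hs' | hs'
      · exact ⟨ha.1.trans_lt hs'.1, lt_of_le_of_ne (hs'.2.trans hb.2) hsS⟩
      · exact ⟨hb.1.trans_lt hs'.1, lt_of_le_of_ne (hs'.2.trans ha.2) hsS⟩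
    rw [h1, hwork]
    ring

end RISystem

/-! ### Compactness of the set of relaxed solutions -/

section Congr

variable {V : Type*} [NormedAddCommGroup V] [InnerProductSpace ℝ V] {S : ℝ}

lemma W1infWeakStar.congr {f u : ℕ → ℝ → V} {g : ℝ → V} (h : W1infWeakStar S f g)
    (hfu : ∀ n, EqOn (u n) (f n) (Ioo 0 S)) : W1infWeakStar S u g := by
  obtain ⟨f', g', hf, hg, hfg, hfg'⟩ := h
  refine ⟨f', g', fun n => (hf n).congr (hfu n), hg,
    ⟨fun n => ((hf n).congr (hfu n)).memLp, hfg.memLp_lim, fun w hw => ?_⟩, hfg'⟩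
  refine (hfg.tendsto w hw).congr fun n => setIntegral_congr_fun measurableSet_Ioo fun s hs => ?_
  simp only [hfu n hs]

lemma BVWeakStar.congr {f u : ℕ → ℝ → V} {g : ℝ → V} (h : BVWeakStar S f g)
    (hfu : ∀ n, EqOn (u n) (f n) (Ioo 0 S)) : BVWeakStar S u g := by
  have hae (n : ℕ) : f n =ᵐ[lebesgueOn S] u n :=
    (ae_restrict_mem measurableSet_Ioo).mono fun s hs => (hfu n hs).symm
  obtain ⟨hL1, μ, ν, hμ, hν, hlim⟩ := h
  refine ⟨hL1.congr fun n => eLpNorm_congr_ae ((hae n).sub EventuallyEq.rfl), μ, ν, fun n => ?_,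
    hν, hlim⟩
  refine ⟨(memLp_congr_ae (hae n)).1 (hμ n).memLp, (hμ n).concentrated, (hμ n).finite_variation,
    fun φ hφ => ?_⟩
  rw [← (hμ n).weak_deriv φ hφ]
  refine setIntegral_congr_fun measurableSet_Ioo fun s hs => ?_
  simp only [hfu n hs]

end Congr

lemma LipschitzWith.eVariationOn_le {V : Type*} [PseudoEMetricSpace V] {S : ℝ} {f : ℝ → V}
    {L : ℝ≥0} (hf : LipschitzWith L f) (hS : 0 ≤ S) (hclamp : ∀ x, f (max 0 (min x S)) = f x) :
    eVariationOn f univ ≤ (L * S.toNNReal : ℝ≥0) := by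
  have h1 : eVariationOn (clampExt S f) univ ≤ eVariationOn f (Icc 0 S) :=
    eVariationOn_clampExt_le hS
  rw [show clampExt S f = f from funext hclamp] at h1
  have h2 : eVariationOn id (Icc 0 S) = ENNReal.ofReal (S - 0) := by
    simpa only [inter_self, id] using (monotone_id.monotoneOn (Icc 0 S)).eVariationOn_eq
      (left_mem_Icc.2 hS) (right_mem_Icc.2 hS)
  refine h1.trans (((hf.lipschitzOnWith (s := univ)).comp_eVariationOn_le (g := id)
    (s := Icc 0 S) (mapsTo_univ _ _)).trans_eq ?_)
  rw [h2, sub_zero, ENNReal.coe_mul, ENNReal.ofReal]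

namespace RISystem

variable {d : ℕ} {P : RISystem d}

local notation "𝕍" => EuclideanSpace ℝ (Fin d)

/-- Compactness for Lipschitz solutions under bounded loads. The compatibility condition of the
limit holds at the increase points that are points of asymptotic equicontinuity of the loads `lh n`
and are mapped by `t'` to points of asymptotic equicontinuity of the loads `l n`; this excludes
only countably many points. -/
lemma StandingAssumptions.exists_subseq_isRelaxedSolution (hP : P.StandingAssumptions) {c : ℝ≥0}
    {l : ℕ → ℝ → 𝕍} {S : ℕ → ℝ} {t : ℕ → ℝ → ℝ} {z lh : ℕ → ℝ → 𝕍}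
    (hsol : ∀ n, P.IsLipschitzSolution c (l n) (S n) (t n) (z n) (lh n)) {K K' : ℝ≥0} {B B' C : ℝ}
    (hvar : ∀ n, eVariationOn (lh n) univ ≤ K) (hB : ∀ n x, ‖lh n x‖ ≤ B)
    (hvar' : ∀ n, eVariationOn (l n) univ ≤ K') (hB' : ∀ n x, ‖l n x‖ ≤ B')
    (hSC : ∀ n, S n ≤ C) (hC : ∀ n x, ‖z n x‖ ≤ C) :
    ∃ (k : ℕ → ℕ) (S' : ℝ) (t' : ℝ → ℝ) (z' lh' l' : ℝ → 𝕍), StrictMono k ∧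
      Tendsto (fun n => S (k n)) atTop (𝓝 S') ∧
      (∀ x, Tendsto (fun n => t (k n) x) atTop (𝓝 (t' x))) ∧
      (∀ x, Tendsto (fun n => z (k n) x) atTop (𝓝 (z' x))) ∧
      (∀ x, Tendsto (fun n => lh (k n) x) atTop (𝓝 (lh' x))) ∧
      (∀ x, Tendsto (fun n => l (k n) x) atTop (𝓝 (l' x))) ∧
      P.IsRelaxedSolution l' S' t' z' lh' := by
  have hvart (n : ℕ) : eVariationOn (t n) univ ≤ (1 * C.toNNReal : ℝ≥0) := by
    refine ((hsol n).t_lip.eVariationOn_le (hsol n).S_pos.le (hsol n).t_clamp).trans ?_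
    gcongr
    exact hSC n
  have hvarz (n : ℕ) : eVariationOn (z n) univ ≤ (c * C.toNNReal : ℝ≥0) := by
    refine ((hsol n).z_lip.eVariationOn_le (hsol n).S_pos.le (hsol n).z_clamp).trans ?_
    gcongr
    exact hSC n
  obtain ⟨S', -, k₀, hk₀, hS⟩ := isCompact_Icc.tendsto_subseq fun n =>
    (⟨(hsol n).T_le, hSC n⟩ : S n ∈ Icc P.T C)
  obtain ⟨k₁, hk₁, t', ht, -⟩ := exists_subseq_tendsto_of_eVariationOn_le
    (f := fun n => t (k₀ n)) (fun n => hvart _) fun n => (hsol (k₀ n)).norm_t_le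
  obtain ⟨k₂, hk₂, z', hz, -⟩ := exists_subseq_tendsto_of_eVariationOn_le
    (f := fun n => z (k₀ (k₁ n))) (fun n => hvarz _) fun n => hC _
  obtain ⟨k₃, hk₃, lh', hlh, D, hD, hequi⟩ := exists_subseq_tendsto_of_eVariationOn_le
    (f := fun n => lh (k₀ (k₁ (k₂ n)))) (fun n => hvar _) fun n => hB _
  obtain ⟨k₄, hk₄, l', hl, D', hD', hequi'⟩ := exists_subseq_tendsto_of_eVariationOn_le
    (f := fun n => l (k₀ (k₁ (k₂ (k₃ n))))) (fun n => hvar' _) fun n => hB' _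
  have h₄ := hk₄.tendsto_atTop
  have h₃ := hk₃.tendsto_atTop.comp h₄
  have h₂ := hk₂.tendsto_atTop.comp h₃
  have h₁ := hk₁.tendsto_atTop.comp h₂
  set k : ℕ → ℕ := fun n => k₀ (k₁ (k₂ (k₃ (k₄ n)))) with hk
  have hS' : Tendsto (fun n => S (k n)) atTop (𝓝 S') := hS.comp h₁
  have ht' (x : ℝ) : Tendsto (fun n => t (k n) x) atTop (𝓝 (t' x)) := (ht x).comp h₂
  have hz' (x : ℝ) : Tendsto (fun n => z (k n) x) atTop (𝓝 (z' x)) := (hz x).comp h₃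
  have hlh' (x : ℝ) : Tendsto (fun n => lh (k n) x) atTop (𝓝 (lh' x)) := (hlh x).comp h₄
  refine ⟨k, S', t', z', lh', l',
    hk₀.comp (hk₁.comp (hk₂.comp (hk₃.comp hk₄))), hS', ht', hz', hlh', hl, deriv t', deriv z',
    hP.isRelaxedSolutionWith_of_tendsto (fun n => hsol (k n)) hS' ht' hz' hlh'
      (fun n => hvar (k n)) (fun n => hB (k n)) (fun n => hC (k n)) ?_⟩
  filter_upwards [hD.ae_notMem volume,
    (countable_increasePoints_inter_preimage (S := S') (t := t') hD').ae_notMem volume]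
    with s hs hs' hinc
  refine compatibility_of_tendsto (fun n => hsol (k n)) hS' ht' hl hlh' hinc (fun ε hε => ?_)
    (hequi' _ fun h => hs' ⟨hinc, h⟩)
  obtain ⟨δ, hδ, h⟩ := hequi s hs ε hε
  exact ⟨δ, hδ, h₄.eventually h⟩

end RISystem

theorem theorem3p4 {d : ℕ} (P : RISystem d) (hP : P.StandingAssumptions)
    (l : ℕ → ℝ → EuclideanSpace ℝ (Fin d))
    (hl_bdd : ∃ K : ℝ≥0, ∀ n, bvNorm P.T (l n) ≤ K)
    (S : ℕ → ℝ) (t : ℕ → ℝ → ℝ) (z lh : ℕ → ℝ → EuclideanSpace ℝ (Fin d))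
    (hsol : ∀ n, P.IsRelaxedSolution (l n) (S n) (t n) (z n) (lh n))
    (hlh_bdd : ∃ K : ℝ≥0, ∀ n, bvNorm (S n) (lh n) ≤ K) :
    ∃ (k : ℕ → ℕ) (S' : ℝ) (t' : ℝ → ℝ) (z' lh' l' : ℝ → EuclideanSpace ℝ (Fin d)),
      StrictMono k ∧
      Tendsto (fun n => S (k n)) atTop (𝓝 S') ∧
      W1infWeakStar S' (fun n => constExt (S (k n)) (z (k n))) z' ∧
      W1infWeakStar S' (fun n => constExt (S (k n)) (t (k n))) t' ∧
      BVWeakStar S' (fun n => constExt (S (k n)) (lh (k n))) lh' ∧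
      BVWeakStar P.T (fun n => l (k n)) l' ∧
      (∀ s ∈ Icc 0 S', Tendsto (fun n => constExt (S (k n)) (lh (k n)) s) atTop (𝓝 (lh' s))) ∧
      (∀ τ ∈ Icc 0 P.T, Tendsto (fun n => l (k n) τ) atTop (𝓝 (l' τ))) ∧
      MemBV P.T l' ∧
      P.IsRelaxedSolution l' S' t' z' lh' := by
  obtain ⟨K', hK'⟩ := hl_bdd
  obtain ⟨K, hK⟩ := hlh_bdd
  obtain ⟨c, hc⟩ := hP.exists_isLipschitzSolution
  have hT := hP.T_pos
  have hLip (n : ℕ) := hc _ _ _ _ _ (hsol n)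
  have hS0 (n : ℕ) : 0 ≤ S n := (hLip n).S_pos.le
  have hvar (n : ℕ) : eVariationOn (clampExt (S n) (lh n)) univ ≤ K :=
    (eVariationOn_clampExt_le (hS0 n)).trans (le_add_self.trans (hK n))
  have hB (n : ℕ) (x : ℝ) : ‖clampExt (S n) (lh n) x‖ ≤ K / P.T + K :=
    norm_le_of_bvNorm_le hT (hLip n).T_le (hK n) (max_zero_min_mem_Icc (hS0 n) x)
  have hvar' (n : ℕ) : eVariationOn (clampExt P.T (l n)) univ ≤ K' :=
    (eVariationOn_clampExt_le hT.le).trans (le_add_self.trans (hK' n))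
  have hB' (n : ℕ) (x : ℝ) : ‖clampExt P.T (l n) x‖ ≤ K' / P.T + K' :=
    norm_le_of_bvNorm_le hT le_rfl (hK' n) (max_zero_min_mem_Icc hT.le x)
  obtain ⟨C, hC⟩ := hP.exists_bound c K (B := K / P.T + K) (by positivity)
  have hC' (n : ℕ) := hC _ _ _ _ _ (hLip n) (hvar n) (hB n)
  obtain ⟨k, S', t', z', lh', l', hk, hS, ht, hz, hlh, hl, hlim⟩ :=
    hP.exists_subseq_isRelaxedSolution hLip hvar hB hvar' hB' (fun n => (hC' n).1)
      fun n => (hC' n).2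
  have hS' : 0 ≤ S' := ge_of_tendsto' hS fun n => hS0 _
  have hext {V : Type} (f : ℕ → ℝ → V) (n : ℕ) :
      EqOn (constExt (S (k n)) (f (k n))) (clampExt (S (k n)) (f (k n))) (Ioo 0 S') :=
    fun s hs => constExt_eq_clampExt (hS0 _) hs.1.le
  have hl' : ∀ τ ∈ Icc 0 P.T, Tendsto (fun n => l (k n) τ) atTop (𝓝 (l' τ)) := fun τ hτ => by
    simpa only [clampExt_of_mem hτ] using hl τ
  refine ⟨k, S', t', z', lh', l', hk, hS, ?_, ?_, ?_, ?_, fun s hs => ?_, hl', ?_, hlim⟩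
  · exact (w1infWeakStar_of_tendsto (fun n => (hLip (k n)).z_lip) (fun n => (hC' (k n)).2) hz
      hS').congr (hext z)
  · exact (w1infWeakStar_of_tendsto (fun n => (hLip (k n)).t_lip) (fun n => (hLip (k n)).norm_t_le)
      ht hS').congr (hext t)
  · exact (bvWeakStar_of_tendsto (fun n => hvar (k n)) (fun n => hB (k n)) hlh hS').congr (hext lh)
  · exact (bvWeakStar_of_tendsto (fun n => hvar' (k n)) (fun n => hB' (k n)) hl hT.le).congr
      fun n s hs => (clampExt_of_mem (Ioo_subset_Icc_self hs)).symm
  · simpa only [constExt_eq_clampExt (hS0 _) hs.1] using hlh s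
  · exact (eVariationOn_le_of_tendsto hl' fun n => le_add_self.trans (hK' (k n))).trans_lt
      ENNReal.coe_lt_top
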